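/- **Notation.** Let $n\ge 2$ and $p\le n$. Let $\widetilde{\operatorname{Gr}}_{n,p}$ be the set of $p$-dimensional subspaces of $\mathbb R^n$, each represented by an $n\times p$ matrix $U$ with orthonormal columns modulo right multiplication by $O(p)$; the map $\tau(U)=UU^T$ identifies it with the set $\operatorname{Gr}_{n,p}$ of rank-$p$ orthogonal projectors. Put $I_{n,p}=\operatorname{diag}(I_p,0)$ and $[A,B]=AB-BA$. For projectors $P,Q$ such that $(I_n-2Q)(I_n-2P)$ does not have the eigenvalue $-1$ ("$P,Q$ are not in each other's cut locus"), let $\operatorname{Log}^{gr}_P(Q)=[\Omega,P]$ with $\Omega=\tfrac12\log\big((I_n-2Q)(I_n-2P)\big)$ (principal logarithm). Let $\operatorname{Exp}^{gr}_P(D)=\exp([D,P])\,P\exp(-[D,P])$ and $\ominus_{gr}P=\operatorname{Exp}^{gr}_{I_{n,p}}(-\operatorname{Log}^{gr}_{I_{n,p}}(P))$, and let $$\langle P,Q\rangle^{gr}=\tfrac12\operatorname{Tr}\big(\operatorname{Log}^{gr}_{I_{n,p}}(P)^T\operatorname{Log}^{gr}_{I_{n,p}}(Q)\big),\quad U\,\widetilde\oplus_{gr}V=\exp\big([\operatorname{Log}^{gr}_{I_{n,p}}(UU^T),I_{n,p}]\big)V,\quad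 \widetilde\ominus_{gr}U=\tau^{-1}\big(\ominus_{gr}(UU^T)\big).$$ Let $\operatorname{Sym}_p^{+,g}$ be the space of $p\times p$ symmetric positive definite matrices with one of the metrics $g\in\{ai,le,lc\}$ (Affine-Invariant, Log-Euclidean, Log-Cholesky). Let $\langle P,Q\rangle^g=\langle \operatorname{Log}^g_{I_p}(P),\operatorname{Log}^g_{I_p}(Q)\rangle^g_{I_p}$, with the following data. Here $\mathscr L(P)$ is the Cholesky factor, $\lfloor\cdot\rfloor$ the strictly lower triangular part and $\mathbb D$ the diagonal part. * $ai$: $P\oplus Q=P^{1/2}QP^{1/2}$, $\ominus P=P^{-1}$, $\operatorname{Log}_{I}(P)=\log P$, $\langle V,W\rangle_{I}=\operatorname{Tr}(VW)+\beta\operatorname{Tr}V\operatorname{Tr}W$ with $\beta>-1/p$. * $le$: $P\oplus Q=\exp(\log P+\log Q)$, $\ominus P=P^{-1}$, $\operatorname{Log}_{I}(P)=\log P$, $\langle V,W\rangle_{I}=\operatorname{Tr}(VW)$. * $lc$: $P\oplus Q=KK^T$ with $K=\lfloor\mathscr L(P)\rfloor+\lfloor\mathscr L(Q)\rfloor+\mathbb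 D(\mathscr L(P))\mathbb D(\mathscr L(Q))$; $\ominus P=KK^T$ with $K=-\lfloor\mathscr L(P)\rfloor+\mathbb D(\mathscr L(P))^{-1}$; $\operatorname{Log}_I(P)=T+T^T$ with $T=\lfloor\mathscr L(P)\rfloor+\log\mathbb D(\mathscr L(P))$; $\langle V,W\rangle_I=\operatorname{Tr}(V_{1/2}^TW_{1/2})$ with $V_{1/2}=\lfloor V\rfloor+\tfrac12\mathbb D(V)$. Fix $\lambda>0$. On $\widetilde{\operatorname{Gr}}_{n,p}\times\operatorname{Sym}_p^{+,g}$ let $\oplus,\ominus$ act componentwise, by $(\widetilde\oplus_{gr},\widetilde\ominus_{gr})$ and $(\oplus_g,\ominus_g)$. Put $\langle (U,S),(V,R)\rangle=\lambda\langle UU^T,VV^T\rangle^{gr}+\langle S,R\rangle^g$, with norms $\|\cdot\|,\|\cdot\|^{gr},\|\cdot\|^g$ induced by the respective inner products. Let $d(P,Q)=\|\ominus P\oplus Q\|$, let $$\mathcal H_{W,P}=\{Q:\ \langle\ominus P\oplus Q,W\rangle \text{ is defined and equal to } 0\},$$ and let the gyroangle $\angle QPR\in[0,\pi]$ be given by $$\cos\angle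 QPR=\frac{\langle\ominus P\oplus Q,\ominus P\oplus R\rangle}{\|\ominus P\oplus Q\|\,\|\ominus P\oplus R\|}.$$ The pseudo-gyrodistance from $X$ to $\mathcal H_{W,P}$ is $\bar d(X,\mathcal H_{W,P})=\sin(\angle XP\overline Q)\,d(X,P)$, where $\overline Q$ maximizes $\cos\angle QPX$ over $Q\in\mathcal H_{W,P}\setminus\{P\}$; by convention the sine is $0$ if $X\in\mathcal H_{W,P}$. **Theorem.** Let $W=(U_W,S_W)$, $P=(U_P,S_P)$, $X=(U_X,S_X)\in\widetilde{\operatorname{Gr}}_{n,p}\times\operatorname{Sym}_p^{+,g}$. Suppose that $\|W\|\neq0$, that $U_WU_W^T$, $U_PU_P^T$, $U_XU_X^T$ are not in the cut locus of $I_{n,p}$, and that $U_PU_P^T$, $U_XU_X^T$ are not in each other's cut locus. If $X\notin\mathcal H_{W,P}$, then a maximizer $\overline Q$ exists and $\sin(\angle XP\overline Q)\,d(X,P)$ does not depend on its choice. In all cases $$\bar d(X,\mathcal H_{W,P})=\frac{\big|\lambda\big\langle(\widetilde\ominus_{gr}U_P\widetilde\oplus_{gr}U_X)(\widetilde\ominus_{gr}U_P\widetilde\oplus_{gr}U_X)^T,\,U_WU_W^T\big\rangle^{gr}+\langle\ominus_gS_P\oplus_gS_X,S_W\rangle^g\big|}{\sqrt{\lambda\big(\|U_WU_W^T\|^{gr}\big)^2+\big(\|S_W\|^g\big)^2}}.$$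 -/

import Mathlib

open Matrix

/-! ### Matrix functions -/

/-- Logarithm of a symmetric positive definite matrix, by the spectral functional calculus. -/
noncomputable def symLog {p : ℕ} (S : Matrix (Fin p) (Fin p) ℝ) : Matrix (Fin p) (Fin p) ℝ :=
  cfc Real.log S

/-- Square root of a symmetric positive definite matrix, by the spectral functional calculus. -/
noncomputable def symSqrt {p : ℕ} (S : Matrix (Fin p) (Fin p) ℝ) : Matrix (Fin p) (Fin p) ℝ :=
  cfc Real.sqrt S

section PrincipalLog

open scoped Matrix.Norms.L2Operator

/-- Principal logarithm of a real orthogonal matrix: the functional calculus of the principal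
branch of the complex logarithm, applied to the complexified (hence normal) matrix. If `-1` is not
an eigenvalue, then this complex matrix has real entries, so that passing to real parts only
changes the coefficient field. -/
noncomputable def principalLog {n : ℕ} (A : Matrix (Fin n) (Fin n) ℝ) :
    Matrix (Fin n) (Fin n) ℝ :=
  (cfc Complex.log (A.map (fun x : ℝ => (x : ℂ)))).map Complex.re

theorem principalLog_transpose {n : ℕ} (A : Matrix (Fin n) (Fin n) ℝ) (hA : Aᵀ * A = 1) :
    (principalLog A)ᵀ = -principalLog A := by
  set B : Matrix (Fin n) (Fin n) ℂ := A.map (fun x : ℝ => (x : ℂ)) with hB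
  have hst : star B = Aᵀ.map (fun x : ℝ => (x : ℂ)) := by
    ext i j
    simp [hB]
  have hu : B ∈ unitary (Matrix (Fin n) (Fin n) ℂ) := by
    have h1 : star B * B = 1 := by
      rw [hst, hB]
      have := congrArg (fun M : Matrix (Fin n) (Fin n) ℝ => M.map (Complex.ofRealHom)) hA
      rw [Matrix.map_mul, Matrix.map_one _ (map_zero _) (map_one _)] at this
      exact this
    exact ⟨h1, mul_eq_one_comm.mp h1⟩
  have hs : star (cfc Complex.log B) = -cfc Complex.log B := by
    rw [← cfc_star, ← cfc_neg]
    apply cfc_congr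
    intro z hz
    have hz1 : ‖z‖ = 1 := by
      have := spectrum.subset_circle_of_unitary hu hz
      simpa using this
    apply Complex.ext <;> simp [Complex.log_re, hz1]
  ext i j
  have := congrArg (fun M : Matrix (Fin n) (Fin n) ℂ => (M i j).re) hs
  simpa [principalLog, star_eq_conjTranspose] using this

end PrincipalLog

/-- Commutator of two square matrices. -/
def matComm {n : ℕ} (A B : Matrix (Fin n) (Fin n) ℝ) : Matrix (Fin n) (Fin n) ℝ := A * B - B * A

/-! ### Symmetric positive definite matrices -/

/-- The Riemannian metrics on `p × p` SPD matrices: Affine-Invariant with parameter `β > -1/p`,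
Log-Euclidean, Log-Cholesky. -/
inductive SPDMetric (p : ℕ) where
  | ai (β : ℝ) (hβ : -(1 / (p : ℝ)) < β)
  | le
  | lc

/-- Real symmetric positive definite `p × p` matrices. -/
abbrev SPD (p : ℕ) := {S : Matrix (Fin p) (Fin p) ℝ // S.PosDef}

/-- Strictly lower triangular part. -/
def strictLower {p : ℕ} (Y : Matrix (Fin p) (Fin p) ℝ) : Matrix (Fin p) (Fin p) ℝ :=
  Matrix.of fun i j => if j < i then Y i j else 0

/-- Lower triangular with positive diagonal. -/
def IsPosLower {p : ℕ} (L : Matrix (Fin p) (Fin p) ℝ) : Prop :=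
  (∀ i j, i < j → L i j = 0) ∧ ∀ i, 0 < L i i

theorem IsPosLower.det_ne_zero {p : ℕ} {L : Matrix (Fin p) (Fin p) ℝ} (h : IsPosLower L) :
    L.det ≠ 0 := by
  rw [Matrix.det_of_isLowerTriangular L (by intro i j hij; exact h.1 i j hij)]
  exact Finset.prod_ne_zero_iff.mpr fun i _ => (h.2 i).ne'

theorem posDef_mul_transpose {p : ℕ} {M : Matrix (Fin p) (Fin p) ℝ} (h : M.det ≠ 0) :
    (M * Mᵀ).PosDef := by
  have h1 : Function.Injective M.vecMul :=
    Matrix.vecMul_injective_of_isUnit ((Matrix.isUnit_iff_isUnit_det M).mpr h.isUnit)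
  simpa using Matrix.PosDef.mul_conjTranspose_self M h1

theorem IsPosLower.of_parts {p : ℕ} (Y : Matrix (Fin p) (Fin p) ℝ) (d : Fin p → ℝ)
    (hd : ∀ i, 0 < d i) : IsPosLower (strictLower Y + Matrix.diagonal d) := by
  refine ⟨fun i j hij => ?_, fun i => ?_⟩
  · simp [strictLower, hij.ne, hij.not_gt]
  · simpa [strictLower] using hd i

theorem exists_cholesky {p : ℕ} (S : SPD p) :
    ∃ L : Matrix (Fin p) (Fin p) ℝ, IsPosLower L ∧ S.1 = L * Lᵀ := by
  have hl : (LDL.lowerInv S.2).IsLowerTriangular := by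
    intro i j hij
    exact LDL.lowerInv_triangular S.2 hij
  have hlow : ∀ i j, i < j → LDL.lower S.2 i j = 0 := by
    intro i j hij
    have h := Matrix.blockTriangular_inv_of_blockTriangular hl
    exact h hij
  have hdet : (LDL.lower S.2).det ≠ 0 := by
    have hS := S.2.det_pos
    intro h0
    rw [← LDL.lower_conj_diag S.2, Matrix.det_mul, Matrix.det_mul, h0] at hS
    simp at hS
  have hL : ∀ i, LDL.lower S.2 i i ≠ 0 := by
    rw [Matrix.det_of_isLowerTriangular _ (by intro i j hij; exact hlow i j hij)] at hdet
    intro i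
    exact Finset.prod_ne_zero_iff.mp hdet i (Finset.mem_univ i)
  have hd : ∀ i, 0 < LDL.diagEntries S.2 i := by
    have hD : (LDL.diag S.2).PosDef := by
      rw [LDL.diag_eq_lowerInv_conj]
      refine S.2.mul_mul_conjTranspose_same (Matrix.vecMul_injective_of_isUnit ?_)
      exact isUnit_of_invertible _
    intro i
    have := hD.diag_pos (i := i)
    simpa [LDL.diag] using this
  set e : Fin p → ℝ := fun i =>
    SignType.sign (LDL.lower S.2 i i) * Real.sqrt (LDL.diagEntries S.2 i) with he
  have hee : ∀ i, e i * e i = LDL.diagEntries S.2 i := by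
    intro i
    have h1 : ((SignType.sign (LDL.lower S.2 i i) : ℝ)) * SignType.sign (LDL.lower S.2 i i) = 1 := by
      rcases lt_or_gt_of_ne (hL i) with h | h <;> simp [h]
    calc e i * e i = ((SignType.sign (LDL.lower S.2 i i) : ℝ) * SignType.sign (LDL.lower S.2 i i))
          * (Real.sqrt (LDL.diagEntries S.2 i) * Real.sqrt (LDL.diagEntries S.2 i)) := by
            rw [he]; ring
      _ = _ := by rw [h1, Real.mul_self_sqrt (hd i).le, one_mul]
  refine ⟨LDL.lower S.2 * Matrix.diagonal e, ⟨fun i j hij => ?_, fun i => ?_⟩, ?_⟩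
  · rw [Matrix.mul_diagonal, hlow i j hij, zero_mul]
  · rw [Matrix.mul_diagonal, he]
    have := Real.sqrt_pos.mpr (hd i)
    rcases lt_or_gt_of_ne (hL i) with h | h
    · have h2 := mul_pos_of_neg_of_neg h (neg_neg_of_pos this)
      simpa [sign_neg h] using h2
    · simpa [sign_pos h] using mul_pos h this
  · conv_lhs => rw [← LDL.lower_conj_diag S.2]
    rw [Matrix.transpose_mul, Matrix.diagonal_transpose, Matrix.mul_assoc, Matrix.mul_assoc,
      ← Matrix.mul_assoc (Matrix.diagonal e), Matrix.diagonal_mul_diagonal]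
    simp only [hee, LDL.diag, Matrix.conjTranspose_eq_transpose_of_trivial]

/-- The Cholesky factor: lower triangular, positive diagonal, `S = L Lᵀ`. -/
noncomputable def cholesky {p : ℕ} (S : SPD p) : Matrix (Fin p) (Fin p) ℝ :=
  (exists_cholesky S).choose

theorem cholesky_spec {p : ℕ} (S : SPD p) :
    IsPosLower (cholesky S) ∧ S.1 = cholesky S * (cholesky S)ᵀ :=
  (exists_cholesky S).choose_spec

theorem posDef_exp {p : ℕ} {A : Matrix (Fin p) (Fin p) ℝ} (hA : Aᵀ = A) :
    (NormedSpace.exp A).PosDef := by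
  have h : NormedSpace.exp A
      = NormedSpace.exp ((1 / 2 : ℝ) • A) * (NormedSpace.exp ((1 / 2 : ℝ) • A))ᵀ := by
    have h2 : A = (1 / 2 : ℝ) • A + (1 / 2 : ℝ) • A := by module
    rw [← Matrix.exp_transpose, Matrix.transpose_smul, hA,
      ← Matrix.exp_add_of_commute _ _ (Commute.refl ((1 / 2 : ℝ) • A)), ← h2]
  have hu : IsUnit (NormedSpace.exp ((1 / 2 : ℝ) • A)) := Matrix.isUnit_exp ((1 / 2 : ℝ) • A)
  have hdet : (NormedSpace.exp ((1 / 2 : ℝ) • A)).det ≠ 0 :=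
    ((Matrix.isUnit_iff_isUnit_det _).mp hu).ne_zero
  rw [h]
  exact posDef_mul_transpose hdet

theorem symLog_transpose {p : ℕ} (S : Matrix (Fin p) (Fin p) ℝ) : (symLog S)ᵀ = symLog S := by
  have h : IsSelfAdjoint (cfc Real.log S) := cfc_predicate _ _
  simpa [symLog, IsSelfAdjoint, star_eq_conjTranspose] using h

theorem symSqrt_conj_posDef {p : ℕ} (P Q : SPD p) :
    (symSqrt P.1 * Q.1 * symSqrt P.1).PosDef := by
  have hsym : (symSqrt P.1)ᵀ = symSqrt P.1 := by
    have h : IsSelfAdjoint (cfc Real.sqrt P.1) := cfc_predicate _ _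
    simpa [symSqrt, IsSelfAdjoint, star_eq_conjTranspose] using h
  have hmul : symSqrt P.1 * symSqrt P.1 = P.1 := by
    have hP : IsSelfAdjoint P.1 := P.2.isHermitian
    rw [symSqrt, ← cfc_mul Real.sqrt Real.sqrt P.1]
    conv_rhs => rw [← cfc_id ℝ P.1 hP]
    apply cfc_congr
    intro x hx
    have hx0 : 0 ≤ x := by
      rw [P.2.isHermitian.spectrum_real_eq_range_eigenvalues] at hx
      obtain ⟨i, rfl⟩ := hx
      exact P.2.posSemidef.eigenvalues_nonneg i
    simp [Real.mul_self_sqrt hx0]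
  have hdet : (symSqrt P.1).det ≠ 0 := by
    intro h0
    have := P.2.det_pos
    rw [← hmul, Matrix.det_mul, h0] at this
    simp at this
  have h1 : Function.Injective (symSqrt P.1).vecMul :=
    Matrix.vecMul_injective_of_isUnit ((Matrix.isUnit_iff_isUnit_det _).mpr hdet.isUnit)
  have := Q.2.mul_mul_conjTranspose_same h1
  simpa [hsym] using this

/-- The binary operation `⊕_g` on SPD matrices. -/
noncomputable def spdAdd {p : ℕ} (g : SPDMetric p) (P Q : SPD p) : SPD p :=
  match g with
  | .ai _ _ => ⟨symSqrt P.1 * Q.1 * symSqrt P.1, symSqrt_conj_posDef P Q⟩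
  | .le => ⟨NormedSpace.exp (symLog P.1 + symLog Q.1), posDef_exp (by
      rw [Matrix.transpose_add, symLog_transpose, symLog_transpose])⟩
  | .lc =>
      ⟨(strictLower (cholesky P + cholesky Q)
          + Matrix.diagonal (fun i => cholesky P i i * cholesky Q i i))
        * (strictLower (cholesky P + cholesky Q)
          + Matrix.diagonal (fun i => cholesky P i i * cholesky Q i i))ᵀ,
        posDef_mul_transpose (IsPosLower.of_parts _ _ fun i =>
          mul_pos ((cholesky_spec P).1.2 i) ((cholesky_spec Q).1.2 i)).det_ne_zero⟩

/-- The inverse operation `⊖_g` on SPD matrices. -/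
noncomputable def spdNeg {p : ℕ} (g : SPDMetric p) (P : SPD p) : SPD p :=
  match g with
  | .ai _ _ => ⟨P.1⁻¹, P.2.inv⟩
  | .le => ⟨P.1⁻¹, P.2.inv⟩
  | .lc =>
      ⟨(strictLower (-cholesky P) + Matrix.diagonal (fun i => (cholesky P i i)⁻¹))
        * (strictLower (-cholesky P) + Matrix.diagonal (fun i => (cholesky P i i)⁻¹))ᵀ,
        posDef_mul_transpose (IsPosLower.of_parts _ _ fun i =>
          inv_pos.mpr ((cholesky_spec P).1.2 i)).det_ne_zero⟩

/-- The Riemannian logarithm at the identity, with values in the symmetric matrices. For the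
Log-Cholesky metric it is `T + Tᵀ`, where `T` is the logarithm in the Cholesky space: the strictly
lower part of the Cholesky factor plus the logarithm of its diagonal. -/
noncomputable def spdLog {p : ℕ} (g : SPDMetric p) (P : SPD p) : Matrix (Fin p) (Fin p) ℝ :=
  match g with
  | .ai _ _ => symLog P.1
  | .le => symLog P.1
  | .lc =>
      (strictLower (cholesky P) + Matrix.diagonal (fun i => Real.log (cholesky P i i)))
        + (strictLower (cholesky P) + Matrix.diagonal (fun i => Real.log (cholesky P i i)))ᵀ

/-- The strictly lower triangular part plus half of the diagonal. -/
noncomputable def halfLower {p : ℕ} (V : Matrix (Fin p) (Fin p) ℝ) : Matrix (Fin p) (Fin p) ℝ :=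
  strictLower V + Matrix.diagonal (fun i => V i i / 2)

/-- The Riemannian metric at the identity matrix, on symmetric matrices. -/
noncomputable def spdMetricAtOne {p : ℕ} (g : SPDMetric p) (V W : Matrix (Fin p) (Fin p) ℝ) : ℝ :=
  match g with
  | .ai β _ => (V * W).trace + β * (V.trace * W.trace)
  | .le => (V * W).trace
  | .lc => ((halfLower V)ᵀ * halfLower W).trace

/-- The SPD inner product. -/
noncomputable def spdInner {p : ℕ} (g : SPDMetric p) (P Q : SPD p) : ℝ :=
  spdMetricAtOne g (spdLog g P) (spdLog g Q)

/-- The norm induced by the SPD inner product. -/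
noncomputable def spdNorm {p : ℕ} (g : SPDMetric p) (P : SPD p) : ℝ :=
  Real.sqrt (spdInner g P P)

/-! ### The Grassmannian in the projector perspective -/

/-- The base point `diag(I_p, 0)`. -/
def baseProj (n p : ℕ) : Matrix (Fin n) (Fin n) ℝ :=
  Matrix.diagonal fun i => if i.val < p then 1 else 0

/-- The two orthogonal projectors `P` and `Q` are not in each other's cut locus: the orthogonal
matrix `(1 - 2Q)(1 - 2P)` does not have the eigenvalue `-1`, so that its principal logarithm, and
with it the Riemannian logarithm of `Q` at `P`, is defined. -/
def OffCut {n : ℕ} (P Q : Matrix (Fin n) (Fin n) ℝ) : Prop :=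
  (-1 : ℝ) ∉ spectrum ℝ ((1 - (2 : ℝ) • Q) * (1 - (2 : ℝ) • P))

/-- The Grassmann logarithmic map of `Q` at `P` (meaningful if `OffCut P Q`). -/
noncomputable def grLog {n : ℕ} (P Q : Matrix (Fin n) (Fin n) ℝ) : Matrix (Fin n) (Fin n) ℝ :=
  matComm ((1 / 2 : ℝ) • principalLog ((1 - (2 : ℝ) • Q) * (1 - (2 : ℝ) • P))) P

/-- The Grassmann exponential map of the tangent vector `D` at `P`. -/
noncomputable def grExp {n : ℕ} (P D : Matrix (Fin n) (Fin n) ℝ) : Matrix (Fin n) (Fin n) ℝ :=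
  NormedSpace.exp (matComm D P) * P * NormedSpace.exp (-matComm D P)

/-- The inverse operation `⊖_gr`. -/
noncomputable def grNeg (n p : ℕ) (P : Matrix (Fin n) (Fin n) ℝ) : Matrix (Fin n) (Fin n) ℝ :=
  grExp (baseProj n p) (-grLog (baseProj n p) P)

/-- The Grassmann inner product: the canonical metric `(1/2) Tr(D₁ᵀ D₂)` at the base point,
evaluated at the logarithms. -/
noncomputable def grInner (n p : ℕ) (P Q : Matrix (Fin n) (Fin n) ℝ) : ℝ :=
  (1 / 2) * ((grLog (baseProj n p) P)ᵀ * grLog (baseProj n p) Q).trace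

/-- The norm induced by the Grassmann inner product. -/
noncomputable def grNorm (n p : ℕ) (P : Matrix (Fin n) (Fin n) ℝ) : ℝ :=
  Real.sqrt (grInner n p P P)

/-! ### The Grassmannian in the orthonormal basis perspective -/

/-- `n × p` matrices with orthonormal columns. -/
abbrev OrthoFrame (n p : ℕ) := {U : Matrix (Fin n) (Fin p) ℝ // Uᵀ * U = 1}

/-- Two orthonormal bases represent the same subspace if they differ by an orthogonal matrix. -/
instance frameSetoid (n p : ℕ) : Setoid (OrthoFrame n p) where
  r U V := ∃ O : Matrix (Fin p) (Fin p) ℝ, O * Oᵀ = 1 ∧ V.1 = U.1 * O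
  iseqv :=
    { refl := fun U => ⟨1, by simp, by simp⟩
      symm := by
        rintro U V ⟨O, hO, hV⟩
        exact ⟨Oᵀ, by simpa using mul_eq_one_comm.mp hO, by
          rw [hV, Matrix.mul_assoc, hO, Matrix.mul_one]⟩
      trans := by
        rintro U V W ⟨O, hO, hV⟩ ⟨R, hR, hW⟩
        refine ⟨O * R, ?_, by rw [hW, hV, Matrix.mul_assoc]⟩
        rw [Matrix.transpose_mul, Matrix.mul_assoc, ← Matrix.mul_assoc R, hR, Matrix.one_mul, hO] }

/-- The `p`-dimensional subspaces of `ℝⁿ`, as classes of orthonormal bases. -/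
abbrev GrONB (n p : ℕ) := Quotient (frameSetoid n p)

/-- The map `τ`, `U ↦ U Uᵀ`. -/
def tau {n p : ℕ} : GrONB n p → Matrix (Fin n) (Fin n) ℝ :=
  Quotient.lift (fun U : OrthoFrame n p => U.1 * U.1ᵀ) (by
    rintro U V ⟨O, hO, hV⟩
    rw [hV, Matrix.transpose_mul, Matrix.mul_assoc, ← Matrix.mul_assoc O, hO, Matrix.one_mul])

/-- The orthogonal matrix `exp([Log (U Uᵀ), diag(I_p, 0)])` by which `U ⊕ ·` acts. -/
noncomputable def transl {n p : ℕ} (U : GrONB n p) : Matrix (Fin n) (Fin n) ℝ :=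
  NormedSpace.exp (matComm (grLog (baseProj n p) (tau U)) (baseProj n p))

theorem tau_transpose {n p : ℕ} (U : GrONB n p) : (tau U)ᵀ = tau U := by
  induction U using Quotient.inductionOn with
  | h U => simp [tau]

theorem tau_sq {n p : ℕ} (U : GrONB n p) : tau U * tau U = tau U := by
  induction U using Quotient.inductionOn with
  | h U =>
    change U.1 * U.1ᵀ * (U.1 * U.1ᵀ) = U.1 * U.1ᵀ
    rw [Matrix.mul_assoc, ← Matrix.mul_assoc U.1ᵀ, U.2, Matrix.one_mul]

theorem reflection_sq {n : ℕ} {P : Matrix (Fin n) (Fin n) ℝ} (h : P * P = P) :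
    (1 - (2 : ℝ) • P) * (1 - (2 : ℝ) • P) = 1 := by
  simp only [sub_mul, mul_sub, one_mul, mul_one, smul_mul_assoc, mul_smul_comm, h]
  module

theorem transl_orthogonal {n p : ℕ} (U : GrONB n p) : (transl U)ᵀ * transl U = 1 := by
  have hb : (baseProj n p)ᵀ = baseProj n p := by simp [baseProj]
  have hb2 : baseProj n p * baseProj n p = baseProj n p := by
    simp [baseProj]
  have hA : ((1 - (2 : ℝ) • tau U) * (1 - (2 : ℝ) • baseProj n p))ᵀ
      * ((1 - (2 : ℝ) • tau U) * (1 - (2 : ℝ) • baseProj n p)) = 1 := by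
    rw [Matrix.transpose_mul, Matrix.transpose_sub, Matrix.transpose_sub, Matrix.transpose_smul,
      Matrix.transpose_smul, hb, tau_transpose, Matrix.transpose_one, Matrix.mul_assoc,
      ← Matrix.mul_assoc (1 - (2 : ℝ) • tau U), reflection_sq (tau_sq U), Matrix.one_mul,
      reflection_sq hb2]
  have hl := principalLog_transpose _ hA
  have hk : (matComm (grLog (baseProj n p) (tau U)) (baseProj n p))ᵀ
      = -matComm (grLog (baseProj n p) (tau U)) (baseProj n p) := by
    rw [grLog]
    generalize principalLog _ = L at hl
    generalize baseProj n p = B at hb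
    simp only [matComm, Matrix.transpose_sub, Matrix.transpose_mul, Matrix.transpose_smul, hb, hl]
    simp only [smul_neg, Matrix.mul_sub, Matrix.sub_mul, Matrix.neg_mul, Matrix.mul_neg,
      Matrix.mul_assoc]
    abel
  generalize hK : matComm (grLog (baseProj n p) (tau U)) (baseProj n p) = K at hk
  have hc : Commute (-K) K := Commute.neg_left (Commute.refl K)
  rw [transl, hK, ← Matrix.exp_transpose, hk, ← Matrix.exp_add_of_commute _ _ hc, neg_add_cancel,
    NormedSpace.exp_zero]

/-- The binary operation on the Grassmannian in the orthonormal basis perspective. -/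
noncomputable def onbAdd {n p : ℕ} (U V : GrONB n p) : GrONB n p :=
  Quotient.map (fun V : OrthoFrame n p => (⟨transl U * V.1, by
      rw [Matrix.transpose_mul, Matrix.mul_assoc, ← Matrix.mul_assoc _ (transl U),
        transl_orthogonal, Matrix.one_mul, V.2]⟩ : OrthoFrame n p))
    (by
      rintro V W ⟨O, hO, hW⟩
      exact ⟨O, hO, by change transl U * W.1 = transl U * V.1 * O; rw [hW, Matrix.mul_assoc]⟩) V

/-- The inverse operation `τ⁻¹(⊖_gr (U Uᵀ))` in the orthonormal basis perspective. -/
noncomputable def onbNeg {n p : ℕ} (U : GrONB n p) : GrONB n p :=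
  @Function.invFun (GrONB n p) (Matrix (Fin n) (Fin n) ℝ) ⟨U⟩ tau (grNeg n p (tau U))

/-! ### Structure spaces -/

/-- The structure space. -/
abbrev StructureSpace (n p : ℕ) := GrONB n p × SPD p

/-- The binary operation in the structure space. -/
noncomputable def psdAdd {n p : ℕ} (g : SPDMetric p) (P Q : StructureSpace n p) :
    StructureSpace n p :=
  (onbAdd P.1 Q.1, spdAdd g P.2 Q.2)

/-- The inverse operation in the structure space. -/
noncomputable def psdNeg {n p : ℕ} (g : SPDMetric p) (P : StructureSpace n p) :
    StructureSpace n p :=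
  (onbNeg P.1, spdNeg g P.2)

/-- The inner product in the structure space, with weight `lam` on the Grassmann part. -/
noncomputable def psdInner {n p : ℕ} (lam : ℝ) (g : SPDMetric p) (P Q : StructureSpace n p) : ℝ :=
  lam * grInner n p (tau P.1) (tau Q.1) + spdInner g P.2 Q.2

/-- The norm induced by the inner product in the structure space. -/
noncomputable def psdNorm {n p : ℕ} (lam : ℝ) (g : SPDMetric p) (P : StructureSpace n p) : ℝ :=
  Real.sqrt (psdInner lam g P P)

/-- `⊖P ⊕ Q`. -/
noncomputable def psdDiff {n p : ℕ} (g : SPDMetric p) (P Q : StructureSpace n p) :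
    StructureSpace n p :=
  psdAdd g (psdNeg g P) Q

/-- The hypergyroplane `H_{W,P}`: all `Q` for which the inner product of `⊖P ⊕ Q` and `W` is
defined and equals zero. -/
def hypergyroplane {n p : ℕ} (lam : ℝ) (g : SPDMetric p) (W P : StructureSpace n p) :
    Set (StructureSpace n p) :=
  {Q | OffCut (baseProj n p) (tau (psdDiff g P Q).1) ∧ psdInner lam g (psdDiff g P Q) W = 0}

/-- The gyroangle `∠ Q P R`, in `[0, π]`. -/
noncomputable def gyroangle {n p : ℕ} (lam : ℝ) (g : SPDMetric p) (Q P R : StructureSpace n p) :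
    ℝ :=
  Real.arccos (psdInner lam g (psdDiff g P Q) (psdDiff g P R)
    / (psdNorm lam g (psdDiff g P Q) * psdNorm lam g (psdDiff g P R)))

/-- The gyrodistance. -/
noncomputable def gyrodist {n p : ℕ} (lam : ℝ) (g : SPDMetric p) (P Q : StructureSpace n p) : ℝ :=
  psdNorm lam g (psdDiff g P Q)

/-- `R` maximizes `Q ↦ cos (∠ Q P X)` over the hypergyroplane without the point `P`. -/
def IsGyroMaximizer {n p : ℕ} (lam : ℝ) (g : SPDMetric p) (X W P R : StructureSpace n p) : Prop :=
  R ∈ hypergyroplane lam g W P \ {P} ∧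
    ∀ Q ∈ hypergyroplane lam g W P \ {P},
      Real.cos (gyroangle lam g Q P X) ≤ Real.cos (gyroangle lam g R P X)

open Classical in
/-- The pseudo-gyrodistance from `X` to `H_{W,P}`, that is `sin (∠ X P R) * d(X, P)` for a
maximizer `R` of `cos (∠ Q P X)`; by convention the sine is `0` if `X` lies on `H_{W,P}`. (The
value `0` in the absence of a maximizer is a placeholder.) -/
noncomputable def pseudoGyrodist {n p : ℕ} (lam : ℝ) (g : SPDMetric p)
    (X W P : StructureSpace n p) : ℝ :=
  if X ∈ hypergyroplane lam g W P then 0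
  else if h : ∃ R, IsGyroMaximizer lam g X W P R then
    Real.sin (gyroangle lam g X P h.choose) * gyrodist lam g X P
  else 0

/-! ### Principal logarithms of real orthogonal matrices -/

section PrincipalLogarithm

open scoped Matrix.Norms.L2Operator

/-! Off the cut locus, `structLog` turns the problem into linear algebra in the tangent space
`structTangent`, where inner products, norms and gyroangles are computed from the positive
semidefinite form `structForm`. Let x be the logarithm of ⊖P ⊕ X and w that of W. A point Q of the
hypergyroplane gives a vector v with ⟨v, w⟩ = 0. By Cauchy–Schwarz the cosine of the angle between v
and x is at most m = ‖y‖/‖x‖, where y is the projection of x to the complement of w, and √(1 -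
m²)·‖x‖ = |⟨x, w⟩|/‖w‖. This is `exists_formCos_max`.

Three facts link this computation to the gyro-operations. (1) The vector x exists: translation by ⊖P
conjugates the product of the reflections of the pair (P, X) to that of (base point, ⊖P ⊕ X), so the
cut locus condition carries over (`exists_reflections_onbNeg_onbAdd`). (2) The bound m is attained
by a point: left translations are onto, and although the Grassmann logarithm only covers a
neighbourhood of 0, cosines do not change along a ray, so a short multiple of y serves
(`exists_structLog_psdDiff_eq_smul`). If ‖y‖ = 0, all cosines vanish and any nonzero vector
orthogonal to w does; one exists because the tangent space has dimension at least two. (3) The angle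
involves ⊖P ⊕ X, but the distance d(X, P) involves ⊖X ⊕ P. Their norms agree (`gyrodist_comm`): on
the Grassmannian the two reflection products are transposes of each other, so their logarithms
differ by sign; on the SPD factor the logarithms are opposite, or similar up to sign in the
affine-invariant case.

The Grassmann facts rest on one uniqueness principle: a skew matrix with spectrum in the strip |Im
z| < π is the principal logarithm of its exponential (`principalLog_exp`). -/

/-- Entrywise complexification of a real matrix. -/
noncomputable def complexify {n : ℕ} :
    Matrix (Fin n) (Fin n) ℝ →ₐ[ℝ] Matrix (Fin n) (Fin n) ℂ :=
  Complex.ofRealAm.mapMatrix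

theorem complexify_apply {n : ℕ} (A : Matrix (Fin n) (Fin n) ℝ) :
    complexify A = A.map (fun x : ℝ => (x : ℂ)) := rfl

theorem complexify_injective {n : ℕ} : Function.Injective (complexify (n := n)) := by
  intro A B h
  ext i j
  have := congrFun (congrFun h i) j
  simpa [complexify_apply] using this

theorem star_complexify {n : ℕ} (A : Matrix (Fin n) (Fin n) ℝ) :
    star (complexify A) = complexify Aᵀ := by
  ext i j
  simp [complexify_apply]

theorem complexify_exp {n : ℕ} (A : Matrix (Fin n) (Fin n) ℝ) :
    complexify (NormedSpace.exp A) = NormedSpace.exp (complexify A) := by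
  have hc : Continuous (complexify (n := n)) :=
    (complexify (n := n)).toLinearMap.continuous_of_finiteDimensional
  let _ : NormedAlgebra ℚ (Matrix (Fin n) (Fin n) ℝ) := NormedAlgebra.restrictScalars ℚ ℝ _
  exact NormedSpace.map_exp (complexify (n := n)) hc A

theorem cfc_log_exp {n : ℕ} {L : Matrix (Fin n) (Fin n) ℂ} (hL : star L = -L)
    (hs : ∀ z ∈ spectrum ℂ L, |z.im| < Real.pi) :
    cfc Complex.log (NormedSpace.exp L) = L := by
  have hn : IsStarNormal L := ⟨by rw [hL]; exact (Commute.refl L).neg_left⟩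
  -- Every function is continuous on a finite set, so the branch cut of `Complex.log` does not
  -- obstruct the functional calculus.
  have hf : (spectrum ℂ L).Finite := Matrix.finite_spectrum L
  rw [← CFC.complex_exp_eq_normedSpace_exp (a := L) hn,
    ← cfc_comp Complex.log Complex.exp L hn ((hf.image _).continuousOn _) (hf.continuousOn _)]
  conv_rhs => rw [← cfc_id ℂ L hn]
  apply cfc_congr
  intro z hz
  have := abs_lt.mp (hs z hz)
  exact Complex.log_exp this.1 this.2.le

theorem mem_unitary_complexify {n : ℕ} {A : Matrix (Fin n) (Fin n) ℝ} (hA : Aᵀ * A = 1) :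
    complexify A ∈ unitary (Matrix (Fin n) (Fin n) ℂ) := by
  have h1 : star (complexify A) * complexify A = 1 := by
    rw [star_complexify, ← map_mul, hA, map_one]
  exact ⟨h1, mul_eq_one_comm.mp h1⟩

theorem neg_one_notMem_spectrum_complexify {n : ℕ} {A : Matrix (Fin n) (Fin n) ℝ}
    (h : (-1 : ℝ) ∉ spectrum ℝ A) : (-1 : ℂ) ∉ spectrum ℂ (complexify A) := by
  rw [spectrum.notMem_iff] at h ⊢
  have := h.map complexify
  simpa using this

theorem norm_eq_one_of_mem_spectrum {n : ℕ} {A : Matrix (Fin n) (Fin n) ℝ} (hA : Aᵀ * A = 1)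
    {z : ℂ} (hz : z ∈ spectrum ℂ (complexify A)) : ‖z‖ = 1 := by
  simpa using spectrum.subset_circle_of_unitary (mem_unitary_complexify hA) hz

theorem isStarNormal_complexify {n : ℕ} {A : Matrix (Fin n) (Fin n) ℝ} (hA : Aᵀ * A = 1) :
    IsStarNormal (complexify A) := by
  have h := mem_unitary_complexify hA
  exact ⟨by rw [commute_iff_eq, h.1, h.2]⟩

theorem star_cfc_log {n : ℕ} {A : Matrix (Fin n) (Fin n) ℝ} (hA : Aᵀ * A = 1) :
    star (cfc Complex.log (complexify A)) = -cfc Complex.log (complexify A) := by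
  rw [← cfc_star, ← cfc_neg]
  apply cfc_congr
  intro z hz
  have hz1 := norm_eq_one_of_mem_spectrum hA hz
  apply Complex.ext <;> simp [Complex.log_re, hz1]

theorem exp_cfc_log {n : ℕ} {A : Matrix (Fin n) (Fin n) ℝ} (hA : Aᵀ * A = 1) :
    NormedSpace.exp (cfc Complex.log (complexify A)) = complexify A := by
  have hn := isStarNormal_complexify hA
  have hf : (spectrum ℂ (complexify A)).Finite := Matrix.finite_spectrum _
  rw [← CFC.complex_exp_eq_normedSpace_exp (cfc_predicate _ _),
    ← cfc_comp Complex.exp Complex.log _ hn ((hf.image _).continuousOn _) (hf.continuousOn _)]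
  conv_rhs => rw [← cfc_id ℂ (complexify A) hn]
  apply cfc_congr
  intro z hz
  have hz1 := norm_eq_one_of_mem_spectrum hA hz
  exact Complex.exp_log (by rintro rfl; simp at hz1)

theorem abs_im_lt_pi_of_mem_spectrum_cfc_log {n : ℕ} {A : Matrix (Fin n) (Fin n) ℝ}
    (hA : Aᵀ * A = 1) (h : (-1 : ℝ) ∉ spectrum ℝ A) {z : ℂ}
    (hz : z ∈ spectrum ℂ (cfc Complex.log (complexify A))) : |z.im| < Real.pi := by
  have hn := isStarNormal_complexify hA
  have hf : (spectrum ℂ (complexify A)).Finite := Matrix.finite_spectrum _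
  rw [cfc_map_spectrum Complex.log _ hn (hf.continuousOn _)] at hz
  obtain ⟨w, hw, rfl⟩ := hz
  have hw1 := norm_eq_one_of_mem_spectrum hA hw
  rw [Complex.log_im, abs_lt]
  refine ⟨Complex.neg_pi_lt_arg w, lt_of_le_of_ne (Complex.arg_le_pi w) fun harg => ?_⟩
  have : w = -1 := by
    rw [← Complex.norm_mul_exp_arg_mul_I w, hw1, harg]
    simp
  exact neg_one_notMem_spectrum_complexify h (this ▸ hw)

theorem spectrum_transpose {n : ℕ} (M : Matrix (Fin n) (Fin n) ℂ) :
    spectrum ℂ Mᵀ = spectrum ℂ M := by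
  ext z
  rw [spectrum.mem_iff, spectrum.mem_iff, ← Matrix.isUnit_transpose]
  simp [Matrix.algebraMap_eq_diagonal]

/-- Since the logarithm L is skew-Hermitian, its entrywise conjugate is -Lᵀ. This is a second
logarithm of the real matrix A with spectrum in the strip, so it equals L by uniqueness, and L is
real. An eigenvalue -1 would break the symmetry, because log(-1) = iπ is not fixed by the passage to
the conjugate eigenvalue. -/
theorem complexify_principalLog {n : ℕ} {A : Matrix (Fin n) (Fin n) ℝ}
    (hA : Aᵀ * A = 1) (h : (-1 : ℝ) ∉ spectrum ℝ A) :
    complexify (principalLog A) = cfc Complex.log (complexify A) := by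
  set L := cfc Complex.log (complexify A) with hLdef
  have hs : star L = -L := star_cfc_log hA
  have hconj : -Lᵀ = L := by
    have he : NormedSpace.exp (-Lᵀ) = complexify A := by
      rw [← Matrix.transpose_neg, ← hs, Matrix.exp_transpose, star_eq_conjTranspose,
        Matrix.exp_conjTranspose, exp_cfc_log hA, ← star_eq_conjTranspose, star_complexify]
      simp [complexify_apply, Matrix.transpose_map]
    rw [← cfc_log_exp (L := -Lᵀ), he]
    · have := congrArg Matrix.transpose hs
      ext i j
      simpa using congrArg Neg.neg (congrFun (congrFun this i) j)
    · intro z hz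
      rw [← spectrum.neg_eq, Set.mem_neg, spectrum_transpose] at hz
      simpa using abs_im_lt_pi_of_mem_spectrum_cfc_log hA h hz
  ext i j
  have h1 : (starRingEnd ℂ) (L i j) = L i j := by
    have e1 := congrFun (congrFun hs j) i
    have e2 := congrFun (congrFun hconj i) j
    simp only [Matrix.star_apply, Matrix.neg_apply, Matrix.transpose_apply] at e1 e2
    rw [← e2, map_neg]
    rw [← e2] at e1
    simpa using congrArg Neg.neg (congrArg Neg.neg e1)
  exact Complex.conj_eq_iff_re.mp h1

/-- The complex eigenvalues of a real matrix have imaginary parts in `(-π, π)`. -/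
def InLogStrip {n : ℕ} (M : Matrix (Fin n) (Fin n) ℝ) : Prop :=
  ∀ z ∈ spectrum ℂ (complexify M), |z.im| < Real.pi

theorem InLogStrip.neg {n : ℕ} {M : Matrix (Fin n) (Fin n) ℝ} (h : InLogStrip M) :
    InLogStrip (-M) := by
  intro z hz
  rw [map_neg, ← spectrum.neg_eq, Set.mem_neg] at hz
  simpa using h _ hz

theorem InLogStrip.conj {n : ℕ} {M E F : Matrix (Fin n) (Fin n) ℝ} (h : InLogStrip M)
    (hEF : E * F = 1) : InLogStrip (E * M * F) := by
  intro z hz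
  let u : (Matrix (Fin n) (Fin n) ℂ)ˣ :=
    ⟨complexify E, complexify F, by rw [← map_mul, hEF, map_one],
      by rw [← map_mul, mul_eq_one_comm.mp hEF, map_one]⟩
  have : complexify (E * M * F) = (u : Matrix (Fin n) (Fin n) ℂ) * complexify M
      * (↑u⁻¹ : Matrix (Fin n) (Fin n) ℂ) := by
    rw [map_mul, map_mul]; rfl
  rw [this, spectrum.units_conjugate] at hz
  exact h z hz

theorem inLogStrip_of_norm_lt {n : ℕ} {M : Matrix (Fin n) (Fin n) ℝ}
    (h : ‖complexify M‖ < Real.pi) : InLogStrip M := by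
  intro z hz
  rcases isEmpty_or_nonempty (Fin n) with hn | hn
  · have : Subsingleton (Matrix (Fin n) (Fin n) ℂ) := inferInstance
    simp [spectrum.of_subsingleton] at hz
  · exact (Complex.abs_im_le_norm z).trans_lt ((spectrum.norm_le_norm_of_mem hz).trans_lt h)

theorem exists_inLogStrip_smul {n : ℕ} (M : Matrix (Fin n) (Fin n) ℝ) :
    ∃ ε : ℝ, 0 < ε ∧ ∀ t : ℝ, 0 < t → t ≤ ε → InLogStrip (t • M) := by
  refine ⟨1 / (‖complexify M‖ + 1), by positivity, fun t ht hte => inLogStrip_of_norm_lt ?_⟩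
  rw [map_smul, norm_smul, Real.norm_of_nonneg ht.le]
  calc t * ‖complexify M‖ ≤ 1 / (‖complexify M‖ + 1) * ‖complexify M‖ := by gcongr
    _ ≤ 1 := by
      rw [one_div_mul_eq_div, div_le_one (by positivity)]
      linarith
    _ < Real.pi := by linarith [Real.pi_gt_three]

theorem inLogStrip_principalLog {n : ℕ} {A : Matrix (Fin n) (Fin n) ℝ}
    (hA : Aᵀ * A = 1) (h : (-1 : ℝ) ∉ spectrum ℝ A) : InLogStrip (principalLog A) := by
  intro z hz
  rw [complexify_principalLog hA h] at hz
  exact abs_im_lt_pi_of_mem_spectrum_cfc_log hA h hz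

theorem exp_principalLog {n : ℕ} {A : Matrix (Fin n) (Fin n) ℝ}
    (hA : Aᵀ * A = 1) (h : (-1 : ℝ) ∉ spectrum ℝ A) : NormedSpace.exp (principalLog A) = A := by
  apply complexify_injective
  rw [complexify_exp, complexify_principalLog hA h, exp_cfc_log hA]

theorem principalLog_exp {n : ℕ} {M : Matrix (Fin n) (Fin n) ℝ} (hM : Mᵀ = -M)
    (hs : InLogStrip M) : principalLog (NormedSpace.exp M) = M := by
  have h1 : star (complexify M) = -complexify M := by rw [star_complexify, hM, map_neg]
  rw [principalLog, ← complexify_apply, complexify_exp, cfc_log_exp h1 hs]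
  ext i j
  simp [complexify_apply]

theorem neg_one_notMem_spectrum_exp {n : ℕ} {M : Matrix (Fin n) (Fin n) ℝ} (hM : Mᵀ = -M)
    (hs : InLogStrip M) : (-1 : ℝ) ∉ spectrum ℝ (NormedSpace.exp M) := by
  intro h
  have h1 : star (complexify M) = -complexify M := by rw [star_complexify, hM, map_neg]
  have hn : IsStarNormal (complexify M) := ⟨by rw [h1]; exact (Commute.refl _).neg_left⟩
  have h2 : (-1 : ℂ) ∈ spectrum ℂ (complexify (NormedSpace.exp M)) := by
    rw [Matrix.mem_spectrum_iff_isRoot_charpoly] at h ⊢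
    have := h.map (f := Complex.ofRealHom)
    rw [← Matrix.charpoly_map] at this
    rw [map_neg, map_one] at this
    exact this
  have hf : (spectrum ℂ (complexify M)).Finite := Matrix.finite_spectrum _
  rw [complexify_exp, ← CFC.complex_exp_eq_normedSpace_exp (a := complexify M) hn,
    cfc_map_spectrum Complex.exp _ hn (hf.continuousOn _)] at h2
  obtain ⟨z, hz, hez⟩ := h2
  obtain ⟨hz1, hz2⟩ := abs_lt.mp (hs z hz)
  -- A solution of exp z = -1 in the open strip would be log(-1) = iπ, which lies on its boundary.
  have := congrArg Complex.log hez
  rw [Complex.log_exp hz1 hz2.le] at this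
  simp [Complex.log_neg_one] at this
  simp [this] at hz2

theorem transpose_exp_mul_exp {n : ℕ} {M : Matrix (Fin n) (Fin n) ℝ} (hM : Mᵀ = -M) :
    (NormedSpace.exp M)ᵀ * NormedSpace.exp M = 1 := by
  rw [← Matrix.exp_transpose, hM, ← Matrix.exp_add_of_commute _ _ (Commute.refl M).neg_left,
    neg_add_cancel, NormedSpace.exp_zero]

/-- The conjugated logarithm is skew, has the same spectrum and exponentiates to the conjugated
matrix, so uniqueness applies. The transposition rule below follows the same pattern. -/
theorem principalLog_orthogonal_conj {n : ℕ} {A E : Matrix (Fin n) (Fin n) ℝ} (hA : Aᵀ * A = 1)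
    (h : (-1 : ℝ) ∉ spectrum ℝ A) (hE : Eᵀ * E = 1) :
    principalLog (E * A * Eᵀ) = E * principalLog A * Eᵀ := by
  have ht := principalLog_transpose A hA
  have hE' := mul_eq_one_comm.mp hE
  have hsk : (E * principalLog A * Eᵀ)ᵀ = -(E * principalLog A * Eᵀ) := by
    simp [Matrix.transpose_mul, ht, Matrix.mul_assoc]
  have hexp : NormedSpace.exp (E * principalLog A * Eᵀ) = E * A * Eᵀ := by
    have := Matrix.exp_conj E (principalLog A) ⟨⟨E, Eᵀ, hE', hE⟩, rfl⟩
    rwa [Matrix.inv_eq_left_inv hE, exp_principalLog hA h] at this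
  rw [← hexp, principalLog_exp hsk ((inLogStrip_principalLog hA h).conj hE')]

theorem principalLog_of_transpose {n : ℕ} {A : Matrix (Fin n) (Fin n) ℝ} (hA : Aᵀ * A = 1)
    (h : (-1 : ℝ) ∉ spectrum ℝ A) : principalLog Aᵀ = -principalLog A := by
  have ht := principalLog_transpose A hA
  have hexp : NormedSpace.exp (-principalLog A) = Aᵀ := by
    rw [← ht, Matrix.exp_transpose, exp_principalLog hA h]
  rw [← hexp, principalLog_exp (by rw [Matrix.transpose_neg, ht])
    (inLogStrip_principalLog hA h).neg]

/-- Applied with J the reflection at the base point, this makes the logarithm of a product of two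
reflections off-diagonal. -/
theorem principalLog_conj {n : ℕ} {A J : Matrix (Fin n) (Fin n) ℝ} (hA : Aᵀ * A = 1)
    (h : (-1 : ℝ) ∉ spectrum ℝ A) (hJ : J * J = 1) (hJt : Jᵀ = J) (hAJ : J * A * J = Aᵀ) :
    J * principalLog A * J = -principalLog A := by
  have := principalLog_orthogonal_conj hA h (E := J) (by rw [hJt, hJ])
  rw [hJt, hAJ, principalLog_of_transpose hA h] at this
  exact this.symm

end PrincipalLogarithm

/-! ### The Grassmannian: geodesics from the base point, translations and norms -/

section Grassmannian

theorem baseProj_transpose (n p : ℕ) : (baseProj n p)ᵀ = baseProj n p := by simp [baseProj]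

theorem baseProj_mul_self (n p : ℕ) : baseProj n p * baseProj n p = baseProj n p := by
  simp [baseProj]

theorem tau_mk {n p : ℕ} (U : OrthoFrame n p) :
    tau (Quotient.mk (frameSetoid n p) U) = U.1 * U.1ᵀ := rfl

theorem reflection_transpose {n : ℕ} {P : Matrix (Fin n) (Fin n) ℝ} (h : Pᵀ = P) :
    (1 - (2 : ℝ) • P)ᵀ = 1 - (2 : ℝ) • P := by
  rw [Matrix.transpose_sub, Matrix.transpose_smul, h, Matrix.transpose_one]

theorem transpose_mul_reflections {n : ℕ} {P Q : Matrix (Fin n) (Fin n) ℝ} (hP : Pᵀ = P)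
    (hP2 : P * P = P) (hQ : Qᵀ = Q) (hQ2 : Q * Q = Q) :
    ((1 - (2 : ℝ) • Q) * (1 - (2 : ℝ) • P))ᵀ * ((1 - (2 : ℝ) • Q) * (1 - (2 : ℝ) • P)) = 1 := by
  rw [Matrix.transpose_mul, reflection_transpose hP, reflection_transpose hQ, Matrix.mul_assoc,
    ← Matrix.mul_assoc (1 - (2 : ℝ) • Q), reflection_sq hQ2, Matrix.one_mul, reflection_sq hP2]

/-- Matrices that are off-diagonal with respect to the block decomposition given by `B`. -/
def IsOffDiag {n : ℕ} (B M : Matrix (Fin n) (Fin n) ℝ) : Prop := M * B + B * M = M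

theorem IsOffDiag.of_reflection_conj {n : ℕ} {B M : Matrix (Fin n) (Fin n) ℝ} (hB : B * B = B)
    (h : (1 - (2 : ℝ) • B) * M * (1 - (2 : ℝ) • B) = -M) : IsOffDiag B M := by
  have h1 : (1 - (2 : ℝ) • B) * M = -M * (1 - (2 : ℝ) • B) := by
    rw [← h, Matrix.mul_assoc _ (1 - (2 : ℝ) • B), reflection_sq hB, Matrix.mul_one]
  simp only [sub_mul, mul_sub, one_mul, mul_one, smul_mul_assoc, mul_smul_comm, neg_mul,
    smul_neg] at h1
  have h2 : (2 : ℝ) • (M * B + B * M) = (2 : ℝ) • M := by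
    rw [smul_add, two_smul ℝ M]
    generalize M * B = a, B * M = b at h1
    ext i j
    have := congrFun (congrFun h1 i) j
    simp only [Matrix.add_apply, Matrix.sub_apply, Matrix.neg_apply, Matrix.smul_apply,
      smul_eq_mul] at this ⊢
    linarith
  exact smul_right_injective _ (two_ne_zero' ℝ) h2

theorem IsOffDiag.reflection_conj {n : ℕ} {B M : Matrix (Fin n) (Fin n) ℝ} (hB : B * B = B)
    (h : IsOffDiag B M) : (1 - (2 : ℝ) • B) * M * (1 - (2 : ℝ) • B) = -M := by
  have h1 : (1 - (2 : ℝ) • B) * M = -M * (1 - (2 : ℝ) • B) := by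
    simp only [sub_mul, mul_sub, one_mul, mul_one, smul_mul_assoc, mul_smul_comm, neg_mul,
      smul_neg]
    have h2 : (2 : ℝ) • (M * B) + (2 : ℝ) • (B * M) = M + M := by
      rw [← smul_add, h, two_smul]
    generalize M * B = a, B * M = b at h2 ⊢
    ext i j
    have := congrFun (congrFun h2 i) j
    simp only [Matrix.add_apply, Matrix.sub_apply, Matrix.neg_apply, Matrix.smul_apply,
      smul_eq_mul] at this ⊢
    linarith
  rw [h1, Matrix.mul_assoc, reflection_sq hB, Matrix.mul_one]

theorem IsOffDiag.sandwich {n : ℕ} {B M : Matrix (Fin n) (Fin n) ℝ} (hB : B * B = B)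
    (h : IsOffDiag B M) : B * M * B = 0 := by
  have := congrArg (B * ·) h
  simp only [Matrix.mul_add, ← Matrix.mul_assoc, hB] at this
  simpa using this

/-- Off-diagonal blocks satisfy BMB = 0, which makes the commutator with B an involution on them. It
exchanges the tangent vectors (symmetric) with the geodesic velocities (skew). -/
theorem IsOffDiag.matComm_matComm {n : ℕ} {B M : Matrix (Fin n) (Fin n) ℝ} (hB : B * B = B)
    (h : IsOffDiag B M) : matComm (matComm M B) B = M := by
  have h0 := h.sandwich hB
  simp only [matComm, Matrix.sub_mul, Matrix.mul_sub, Matrix.mul_assoc, hB]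
  simp only [← Matrix.mul_assoc, hB, h0]
  conv_rhs => rw [← h]
  abel

theorem IsOffDiag.matComm {n : ℕ} {B M : Matrix (Fin n) (Fin n) ℝ} (hB : B * B = B)
    (h : IsOffDiag B M) : IsOffDiag B (matComm M B) := by
  have h0 := h.sandwich hB
  simp only [IsOffDiag, _root_.matComm, Matrix.sub_mul, Matrix.mul_sub, Matrix.mul_assoc, hB]
  simp only [← Matrix.mul_assoc, hB, h0]
  abel

theorem IsOffDiag.smul {n : ℕ} {B M : Matrix (Fin n) (Fin n) ℝ}
    (h : IsOffDiag B M) (c : ℝ) : IsOffDiag B (c • M) := by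
  rw [IsOffDiag, Matrix.smul_mul, Matrix.mul_smul, ← smul_add, h]

theorem IsOffDiag.neg {n : ℕ} {B M : Matrix (Fin n) (Fin n) ℝ}
    (h : IsOffDiag B M) : IsOffDiag B (-M) := by
  rw [IsOffDiag, Matrix.neg_mul, Matrix.mul_neg, ← neg_add, h]

theorem matComm_neg_left {n : ℕ} (A B : Matrix (Fin n) (Fin n) ℝ) :
    matComm (-A) B = -matComm A B := by
  simp [matComm]; abel

theorem matComm_smul_left {n : ℕ} (c : ℝ) (A B : Matrix (Fin n) (Fin n) ℝ) :
    matComm (c • A) B = c • matComm A B := by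
  simp [matComm, smul_sub]

theorem matComm_transpose {n : ℕ} {M B : Matrix (Fin n) (Fin n) ℝ} (hB : Bᵀ = B) :
    (matComm M B)ᵀ = -matComm Mᵀ B := by
  simp [matComm, Matrix.transpose_sub, Matrix.transpose_mul, hB]

/-- The tangent space of the projector model at the base point. -/
def grTangent (n p : ℕ) : Submodule ℝ (Matrix (Fin n) (Fin n) ℝ) where
  carrier := {D | Dᵀ = D ∧ IsOffDiag (baseProj n p) D}
  add_mem' := by
    rintro A B ⟨hA, hA'⟩ ⟨hB, hB'⟩
    refine ⟨by rw [Matrix.transpose_add, hA, hB], ?_⟩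
    rw [IsOffDiag, Matrix.add_mul, Matrix.mul_add]
    conv_rhs => rw [← hA', ← hB']
    abel
  zero_mem' := by simp [IsOffDiag]
  smul_mem' := by
    rintro c A ⟨hA, hA'⟩
    exact ⟨by rw [Matrix.transpose_smul, hA], hA'.smul c⟩

theorem mem_grTangent {n p : ℕ} {D : Matrix (Fin n) (Fin n) ℝ} :
    D ∈ grTangent n p ↔ Dᵀ = D ∧ IsOffDiag (baseProj n p) D := Iff.rfl

/-- The skew-symmetric off-diagonal matrices with eigenvalues of modulus less than `π / 2`, which
are the velocities of minimal geodesics from the base point. -/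
structure IsGeodesicVelocity (n p : ℕ) (M : Matrix (Fin n) (Fin n) ℝ) : Prop where
  skew : Mᵀ = -M
  offDiag : IsOffDiag (baseProj n p) M
  strip : InLogStrip ((2 : ℝ) • M)

theorem IsGeodesicVelocity.neg {n p : ℕ} {M : Matrix (Fin n) (Fin n) ℝ}
    (h : IsGeodesicVelocity n p M) : IsGeodesicVelocity n p (-M) where
  skew := by rw [Matrix.transpose_neg, h.skew]
  offDiag := h.offDiag.neg
  strip := by rw [smul_neg]; exact h.strip.neg

theorem IsOffDiag.reflection_mul_exp {n : ℕ} {B M : Matrix (Fin n) (Fin n) ℝ} (hB : B * B = B)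
    (h : IsOffDiag B M) : (1 - (2 : ℝ) • B) * NormedSpace.exp (-M)
      = NormedSpace.exp M * (1 - (2 : ℝ) • B) := by
  have hJ := reflection_sq hB
  have hc := h.reflection_conj hB
  generalize (1 - (2 : ℝ) • B) = J at *
  have hu : IsUnit J := ⟨⟨J, J, hJ, hJ⟩, rfl⟩
  have hinv : J⁻¹ = J := Matrix.inv_eq_left_inv hJ
  have := Matrix.exp_conj J M hu
  rw [hinv, hc] at this
  rw [this, ← Matrix.mul_assoc, ← Matrix.mul_assoc, hJ, Matrix.one_mul]

theorem exp_mul_exp_neg {n : ℕ} (M : Matrix (Fin n) (Fin n) ℝ) :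
    NormedSpace.exp M * NormedSpace.exp (-M) = 1 := by
  rw [← Matrix.exp_add_of_commute _ _ (Commute.refl M).neg_right, add_neg_cancel,
    NormedSpace.exp_zero]

theorem reflection_conj_exp {n : ℕ} {B M : Matrix (Fin n) (Fin n) ℝ} :
    1 - (2 : ℝ) • (NormedSpace.exp M * B * NormedSpace.exp (-M))
      = NormedSpace.exp M * (1 - (2 : ℝ) • B) * NormedSpace.exp (-M) := by
  simp only [Matrix.mul_sub, Matrix.sub_mul, Matrix.mul_one, exp_mul_exp_neg, Matrix.mul_smul,
    Matrix.smul_mul]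

/-- The reflection at B inverts exp(M), so moving it across doubles the exponent. Hence half the
principal logarithm of this product recovers M when 2M is skew and its spectrum lies in the strip.
-/
theorem IsOffDiag.reflections_exp {n : ℕ} {B M : Matrix (Fin n) (Fin n) ℝ} (hB : B * B = B)
    (h : IsOffDiag B M) :
    (1 - (2 : ℝ) • (NormedSpace.exp M * B * NormedSpace.exp (-M))) * (1 - (2 : ℝ) • B)
      = NormedSpace.exp ((2 : ℝ) • M) := by
  rw [reflection_conj_exp, Matrix.mul_assoc (NormedSpace.exp M), h.reflection_mul_exp hB,
    Matrix.mul_assoc, Matrix.mul_assoc, reflection_sq hB, Matrix.mul_one, two_smul,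
    Matrix.exp_add_of_commute _ _ (Commute.refl M)]

theorem IsGeodesicVelocity.two_smul_skew {n p : ℕ} {M : Matrix (Fin n) (Fin n) ℝ}
    (h : IsGeodesicVelocity n p M) : ((2 : ℝ) • M)ᵀ = -((2 : ℝ) • M) := by
  rw [Matrix.transpose_smul, h.skew, smul_neg]

theorem IsGeodesicVelocity.offCut {n p : ℕ} {M P : Matrix (Fin n) (Fin n) ℝ}
    (h : IsGeodesicVelocity n p M)
    (hP : P = NormedSpace.exp M * baseProj n p * NormedSpace.exp (-M)) :
    OffCut (baseProj n p) P := by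
  rw [OffCut, hP, h.offDiag.reflections_exp (baseProj_mul_self n p)]
  exact neg_one_notMem_spectrum_exp (IsGeodesicVelocity.two_smul_skew h) h.strip

theorem IsGeodesicVelocity.grLog {n p : ℕ} {M P : Matrix (Fin n) (Fin n) ℝ}
    (h : IsGeodesicVelocity n p M)
    (hP : P = NormedSpace.exp M * baseProj n p * NormedSpace.exp (-M)) :
    grLog (baseProj n p) P = matComm M (baseProj n p) := by
  rw [_root_.grLog, hP, h.offDiag.reflections_exp (baseProj_mul_self n p),
    principalLog_exp (IsGeodesicVelocity.two_smul_skew h) h.strip, smul_smul]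
  norm_num

/-- The velocity is half the logarithm of the product of reflections. The geodesic endpoint and `tau
U` then yield the same product with the reflection at the base point, which cancels. -/
theorem exists_isGeodesicVelocity {n p : ℕ} {U : GrONB n p}
    (h : OffCut (baseProj n p) (tau U)) :
    ∃ M, IsGeodesicVelocity n p M
      ∧ tau U = NormedSpace.exp M * baseProj n p * NormedSpace.exp (-M) := by
  have hB := baseProj_mul_self n p
  have hBt := baseProj_transpose n p
  have hA := transpose_mul_reflections hBt hB (tau_transpose U) (tau_sq U)
  have hJ := reflection_sq hB
  set A := (1 - (2 : ℝ) • tau U) * (1 - (2 : ℝ) • baseProj n p) with hAdef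
  have hsk := principalLog_transpose A hA
  have hAJ : (1 - (2 : ℝ) • baseProj n p) * A * (1 - (2 : ℝ) • baseProj n p) = Aᵀ := by
    rw [hAdef, Matrix.transpose_mul, reflection_transpose hBt,
      reflection_transpose (tau_transpose U), Matrix.mul_assoc, Matrix.mul_assoc, hJ,
      Matrix.mul_one]
  have hoff := IsOffDiag.of_reflection_conj hB
    (principalLog_conj hA h hJ (reflection_transpose hBt) hAJ)
  have h2 : (2 : ℝ) • ((1 / 2 : ℝ) • principalLog A) = principalLog A := by
    rw [smul_smul]; norm_num
  have hM : IsGeodesicVelocity n p ((1 / 2 : ℝ) • principalLog A) :=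
    ⟨by rw [Matrix.transpose_smul, hsk, smul_neg], hoff.smul _, by
      rw [h2]; exact inLogStrip_principalLog hA h⟩
  refine ⟨_, hM, ?_⟩
  have hr := hM.offDiag.reflections_exp hB
  rw [h2, exp_principalLog hA h, hAdef] at hr
  have hr2 := congrArg (· * (1 - (2 : ℝ) • baseProj n p)) hr
  simp only [Matrix.mul_assoc _ (1 - (2 : ℝ) • baseProj n p), hJ, Matrix.mul_one] at hr2
  exact (smul_right_injective _ (two_ne_zero' ℝ) (sub_right_injective hr2)).symm

/-- The frame consists of the first p columns of exp(M). The lemma produces points with prescribed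
projectors and shows that `onbNeg`, an `invFun`, has a genuine preimage to choose. -/
theorem exists_tau_eq {n p : ℕ} (hp : p ≤ n) {M : Matrix (Fin n) (Fin n) ℝ} (hM : Mᵀ = -M) :
    ∃ V : GrONB n p, tau V = NormedSpace.exp M * baseProj n p * NormedSpace.exp (-M) := by
  let E : Matrix (Fin n) (Fin p) ℝ :=
    (1 : Matrix (Fin n) (Fin n) ℝ).submatrix id (Fin.castLE hp)
  have hE : Eᵀ * E = 1 := by
    rw [Matrix.transpose_submatrix, Matrix.transpose_one,
      ← Matrix.submatrix_mul _ _ _ id _ Function.bijective_id, Matrix.one_mul]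
    exact Matrix.submatrix_one _ (Fin.castLE_injective hp)
  have hE2 : E * Eᵀ = baseProj n p := by
    ext i j
    simp only [E, Matrix.mul_apply, Matrix.submatrix_apply, Matrix.transpose_apply, id,
      Matrix.one_apply, baseProj, Matrix.diagonal_apply, mul_ite, mul_one, mul_zero]
    by_cases hj : j.val < p
    · rw [Finset.sum_eq_single ⟨j.val, hj⟩]
      · have : Fin.castLE hp ⟨j.val, hj⟩ = j := rfl
        rw [this]
        by_cases hij : i = j <;> simp [hij, hj]
      · intro b _ hb
        rw [if_neg]
        rintro rfl
        exact hb rfl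
      · simp
    · rw [Finset.sum_eq_zero]
      · by_cases hij : i = j <;> simp [hij, hj]
      · intro b _
        rw [if_neg]
        rintro rfl
        exact hj b.2
  have hexp : (NormedSpace.exp M)ᵀ = NormedSpace.exp (-M) := by
    rw [← Matrix.exp_transpose, hM]
  refine ⟨Quotient.mk _ ⟨NormedSpace.exp M * E, ?_⟩, ?_⟩
  · rw [Matrix.transpose_mul, Matrix.mul_assoc, ← Matrix.mul_assoc _ (NormedSpace.exp M),
      transpose_exp_mul_exp hM, Matrix.one_mul, hE]
  · rw [tau_mk]
    simp only [Matrix.transpose_mul, hexp, ← hE2, Matrix.mul_assoc]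

theorem le_of_grONB {n p : ℕ} (U : GrONB n p) : p ≤ n := by
  induction U using Quotient.inductionOn with
  | h U =>
    have h1 : (U.1ᵀ * U.1).rank = p := by rw [U.2, Matrix.rank_one, Fintype.card_fin]
    have h2 := (Matrix.rank_mul_le_right U.1ᵀ U.1).trans (Matrix.rank_le_card_height U.1)
    rwa [h1, Fintype.card_fin] at h2

theorem tau_onbAdd {n p : ℕ} (U V : GrONB n p) :
    tau (onbAdd U V) = transl U * tau V * (transl U)ᵀ := by
  induction V using Quotient.inductionOn with
  | h V =>
    change transl U * V.1 * (transl U * V.1)ᵀ = transl U * (V.1 * V.1ᵀ) * (transl U)ᵀ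
    simp only [Matrix.transpose_mul, Matrix.mul_assoc]

theorem onbAdd_surjective {n p : ℕ} (U : GrONB n p) : Function.Surjective (onbAdd U) := by
  intro V
  induction V using Quotient.inductionOn with
  | h V =>
    have h := mul_eq_one_comm.mp (transl_orthogonal U)
    refine ⟨Quotient.mk _ ⟨(transl U)ᵀ * V.1, ?_⟩, ?_⟩
    · rw [Matrix.transpose_mul, Matrix.transpose_transpose, Matrix.mul_assoc,
        ← Matrix.mul_assoc (transl U), h, Matrix.one_mul, V.2]
    · refine congrArg (Quotient.mk _) (Subtype.ext ?_)
      change transl U * ((transl U)ᵀ * V.1) = V.1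
      rw [← Matrix.mul_assoc, h, Matrix.one_mul]

theorem IsGeodesicVelocity.transl {n p : ℕ} {M : Matrix (Fin n) (Fin n) ℝ} {U : GrONB n p}
    (h : IsGeodesicVelocity n p M)
    (hU : tau U = NormedSpace.exp M * baseProj n p * NormedSpace.exp (-M)) :
    transl U = NormedSpace.exp M := by
  rw [_root_.transl, h.grLog hU, h.offDiag.matComm_matComm (baseProj_mul_self n p)]

theorem IsGeodesicVelocity.tau_onbNeg {n p : ℕ} {M : Matrix (Fin n) (Fin n) ℝ} {U : GrONB n p}
    (h : IsGeodesicVelocity n p M)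
    (hU : tau U = NormedSpace.exp M * baseProj n p * NormedSpace.exp (-M)) :
    tau (onbNeg U) = NormedSpace.exp (-M) * baseProj n p * NormedSpace.exp (- -M) := by
  obtain ⟨V, hV⟩ := exists_tau_eq (le_of_grONB U) h.neg.skew
  have hN : grNeg n p (tau U)
      = NormedSpace.exp (-M) * baseProj n p * NormedSpace.exp (- -M) := by
    rw [grNeg, grExp, h.grLog hU, matComm_neg_left,
      h.offDiag.matComm_matComm (baseProj_mul_self n p)]
  rw [← hN] at hV ⊢
  exact @Function.invFun_eq _ _ ⟨U⟩ tau _ ⟨V, hV⟩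

/-- With M the velocity of U, translation by ⊖U is E = exp(-M), an isometry that carries U to the
base point. Spectral data of the pair (U, V) can therefore be read off at the base point. -/
theorem exists_reflections_onbNeg_onbAdd {n p : ℕ} {U : GrONB n p}
    (hU : OffCut (baseProj n p) (tau U)) (V : GrONB n p) :
    ∃ E : Matrix (Fin n) (Fin n) ℝ, Eᵀ * E = 1 ∧
      (1 - (2 : ℝ) • tau (onbAdd (onbNeg U) V)) * (1 - (2 : ℝ) • baseProj n p)
        = E * ((1 - (2 : ℝ) • tau V) * (1 - (2 : ℝ) • tau U)) * Eᵀ := by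
  obtain ⟨M, hM, hMU⟩ := exists_isGeodesicVelocity hU
  have ht : transl (onbNeg U) = NormedSpace.exp (-M) := hM.neg.transl (hM.tau_onbNeg hMU)
  have ht2 : (NormedSpace.exp (-M))ᵀ = NormedSpace.exp (- -M) := by
    rw [← Matrix.exp_transpose, hM.neg.skew]
  refine ⟨NormedSpace.exp (-M), transpose_exp_mul_exp hM.neg.skew, ?_⟩
  have key : NormedSpace.exp M * (1 - (2 : ℝ) • baseProj n p)
      = (1 - (2 : ℝ) • tau U) * NormedSpace.exp M := by
    have h1 : NormedSpace.exp (-M) * NormedSpace.exp M = 1 := by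
      simpa using exp_mul_exp_neg (-M)
    rw [hMU, reflection_conj_exp, Matrix.mul_assoc _ (NormedSpace.exp (-M)), h1, Matrix.mul_one]
  rw [tau_onbAdd, ht, ht2, reflection_conj_exp, neg_neg, Matrix.mul_assoc, key]
  simp only [← Matrix.mul_assoc]

theorem spectrum_orthogonal_conj {n : ℕ} {E : Matrix (Fin n) (Fin n) ℝ} (hE : Eᵀ * E = 1)
    (A : Matrix (Fin n) (Fin n) ℝ) : spectrum ℝ (E * A * Eᵀ) = spectrum ℝ A :=
  spectrum.units_conjugate (u := (⟨E, Eᵀ, mul_eq_one_comm.mp hE, hE⟩ : (Matrix _ _ ℝ)ˣ))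

theorem offCut_onbNeg_onbAdd {n p : ℕ} {U V : GrONB n p} (hU : OffCut (baseProj n p) (tau U))
    (hUV : OffCut (tau U) (tau V)) :
    OffCut (baseProj n p) (tau (onbAdd (onbNeg U) V)) := by
  obtain ⟨E, hE, h⟩ := exists_reflections_onbNeg_onbAdd hU V
  rw [OffCut, h, spectrum_orthogonal_conj hE]
  exact hUV

theorem OffCut.symm {n p : ℕ} {U V : GrONB n p} (h : OffCut (tau U) (tau V)) :
    OffCut (tau V) (tau U) := by
  rw [OffCut, spectrum.notMem_iff, ← Matrix.isUnit_transpose, Matrix.transpose_sub,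
    Matrix.transpose_mul, reflection_transpose (tau_transpose U),
    reflection_transpose (tau_transpose V), Matrix.algebraMap_eq_diagonal,
    Matrix.diagonal_transpose, ← Matrix.algebraMap_eq_diagonal, ← spectrum.notMem_iff]
  exact h

/-- Of the four products in the expansion, two vanish by BMB = 0 and the other two add up to the
right side because MB + BM = M. -/
theorem trace_matComm_sq {n : ℕ} {B M : Matrix (Fin n) (Fin n) ℝ} (hB : B * B = B)
    (hBt : Bᵀ = B) (hM : Mᵀ = -M) (h : IsOffDiag B M) :
    ((matComm M B)ᵀ * matComm M B).trace = (Mᵀ * M).trace := by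
  have h0 := h.sandwich hB
  rw [matComm_transpose hBt, hM, matComm_neg_left, neg_neg]
  have h1 : (M * B * (M * B)).trace = 0 := by
    rw [Matrix.mul_assoc, ← Matrix.mul_assoc B, h0, Matrix.mul_zero, Matrix.trace_zero]
  have h2 : (B * M * (B * M)).trace = 0 := by
    rw [← Matrix.mul_assoc, h0, Matrix.zero_mul, Matrix.trace_zero]
  have h3 : (M * B * (B * M)).trace = (M * B * M).trace := by
    rw [Matrix.mul_assoc, ← Matrix.mul_assoc B, hB, Matrix.mul_assoc]
  have h4 : (B * M * (M * B)).trace = (B * M * M).trace := by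
    rw [Matrix.trace_mul_comm, Matrix.mul_assoc M, ← Matrix.mul_assoc B, hB, ← Matrix.mul_assoc,
      Matrix.mul_assoc, Matrix.trace_mul_comm]
  have h5 : (M * M).trace = (M * B * M).trace + (B * M * M).trace := by
    rw [← Matrix.trace_add, ← Matrix.add_mul, h]
  simp only [matComm, Matrix.mul_sub, Matrix.sub_mul, Matrix.neg_mul, Matrix.trace_sub,
    Matrix.trace_neg, h1, h2, h3, h4, h5]
  ring

theorem grInner_self {n p : ℕ} {U : GrONB n p} (hU : OffCut (baseProj n p) (tau U)) :
    grInner n p (tau U) (tau U) = 1 / 8 *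
      ((principalLog ((1 - (2 : ℝ) • tau U) * (1 - (2 : ℝ) • baseProj n p)))ᵀ
        * principalLog ((1 - (2 : ℝ) • tau U) * (1 - (2 : ℝ) • baseProj n p))).trace := by
  obtain ⟨M, hM, hMU⟩ := exists_isGeodesicVelocity hU
  rw [grInner, hM.grLog hMU, trace_matComm_sq (baseProj_mul_self n p) (baseProj_transpose n p)
    hM.skew hM.offDiag, hMU, hM.offDiag.reflections_exp (baseProj_mul_self n p),
    principalLog_exp (IsGeodesicVelocity.two_smul_skew hM) hM.strip]
  simp only [Matrix.transpose_smul, Matrix.smul_mul, Matrix.mul_smul, Matrix.trace_smul,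
    smul_eq_mul]
  ring

theorem grInner_onbNeg_onbAdd {n p : ℕ} {U V : GrONB n p}
    (hU : OffCut (baseProj n p) (tau U)) (hUV : OffCut (tau U) (tau V)) :
    grInner n p (tau (onbAdd (onbNeg U) V)) (tau (onbAdd (onbNeg U) V)) = 1 / 8 *
      ((principalLog ((1 - (2 : ℝ) • tau V) * (1 - (2 : ℝ) • tau U)))ᵀ
        * principalLog ((1 - (2 : ℝ) • tau V) * (1 - (2 : ℝ) • tau U))).trace := by
  obtain ⟨E, hE, h⟩ := exists_reflections_onbNeg_onbAdd hU V
  have hA := transpose_mul_reflections (tau_transpose U) (tau_sq U) (tau_transpose V) (tau_sq V)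
  rw [grInner_self (offCut_onbNeg_onbAdd hU hUV), h, principalLog_orthogonal_conj hA hUV hE]
  generalize principalLog _ = L
  have e : (E * L * Eᵀ)ᵀ * (E * L * Eᵀ) = E * (Lᵀ * L) * Eᵀ := by
    simp only [Matrix.transpose_mul, Matrix.transpose_transpose, Matrix.mul_assoc]
    rw [← Matrix.mul_assoc Eᵀ, hE, Matrix.one_mul]
  rw [e, Matrix.trace_mul_comm, ← Matrix.mul_assoc, hE, Matrix.one_mul]

/-- Exchanging U and V transposes the product of reflections and so changes only the sign of its
logarithm. -/
theorem grInner_diff_comm {n p : ℕ} {U V : GrONB n p}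
    (hU : OffCut (baseProj n p) (tau U)) (hV : OffCut (baseProj n p) (tau V))
    (hUV : OffCut (tau U) (tau V)) :
    grInner n p (tau (onbAdd (onbNeg U) V)) (tau (onbAdd (onbNeg U) V))
      = grInner n p (tau (onbAdd (onbNeg V) U)) (tau (onbAdd (onbNeg V) U)) := by
  have hA := transpose_mul_reflections (tau_transpose U) (tau_sq U) (tau_transpose V) (tau_sq V)
  have ht : (1 - (2 : ℝ) • tau U) * (1 - (2 : ℝ) • tau V)
      = ((1 - (2 : ℝ) • tau V) * (1 - (2 : ℝ) • tau U))ᵀ := by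
    rw [Matrix.transpose_mul, reflection_transpose (tau_transpose U),
      reflection_transpose (tau_transpose V)]
  rw [grInner_onbNeg_onbAdd hU hUV, grInner_onbNeg_onbAdd hV hUV.symm, ht,
    principalLog_of_transpose hA hUV, Matrix.transpose_neg, neg_mul_neg]

theorem grLog_mem_grTangent {n p : ℕ} {U : GrONB n p} (hU : OffCut (baseProj n p) (tau U)) :
    grLog (baseProj n p) (tau U) ∈ grTangent n p := by
  obtain ⟨M, hM, hMU⟩ := exists_isGeodesicVelocity hU
  rw [hM.grLog hMU, mem_grTangent, matComm_transpose (baseProj_transpose n p), hM.skew,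
    matComm_neg_left, neg_neg]
  exact ⟨rfl, hM.offDiag.matComm (baseProj_mul_self n p)⟩

/-- Small tangent vectors at the base point are logarithms. -/
theorem exists_grLog_eq_smul {n p : ℕ} (hp : p ≤ n) {D : Matrix (Fin n) (Fin n) ℝ}
    (hD : D ∈ grTangent n p) :
    ∃ ε : ℝ, 0 < ε ∧ ∀ t : ℝ, 0 < t → t ≤ ε → ∃ V : GrONB n p,
      OffCut (baseProj n p) (tau V) ∧ grLog (baseProj n p) (tau V) = t • D := by
  have hB := baseProj_mul_self n p
  -- The factor 2 is there because the strip condition on a geodesic velocity M concerns 2M.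
  obtain ⟨ε, hε, h⟩ := exists_inLogStrip_smul ((2 : ℝ) • matComm D (baseProj n p))
  refine ⟨ε, hε, fun t ht hte => ?_⟩
  have hM : IsGeodesicVelocity n p (t • matComm D (baseProj n p)) :=
    ⟨by rw [Matrix.transpose_smul, matComm_transpose (baseProj_transpose n p), hD.1, smul_neg],
      (hD.2.matComm hB).smul t, by rw [smul_comm]; exact h t ht hte⟩
  obtain ⟨V, hV⟩ := exists_tau_eq hp hM.skew
  refine ⟨V, hM.offCut hV, ?_⟩
  rw [hM.grLog hV, matComm_smul_left, hD.2.matComm_matComm hB]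

end Grassmannian

/-! ### Positive definite matrices: logarithms, translations and symmetry of the norm -/

section PositiveDefinite

theorem pos_of_mem_spectrum {p : ℕ} (S : SPD p) {x : ℝ} (hx : x ∈ spectrum ℝ S.1) : 0 < x := by
  rw [S.2.isHermitian.spectrum_real_eq_range_eigenvalues] at hx
  obtain ⟨i, rfl⟩ := hx
  exact S.2.eigenvalues_pos i

theorem isSelfAdjoint_of_transpose_eq {p : ℕ} {D : Matrix (Fin p) (Fin p) ℝ} (hD : Dᵀ = D) :
    IsSelfAdjoint D := by
  rw [IsSelfAdjoint, star_eq_conjTranspose, Matrix.conjTranspose_eq_transpose_of_trivial, hD]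

open scoped Matrix.Norms.L2Operator in
theorem symLog_exp {p : ℕ} {D : Matrix (Fin p) (Fin p) ℝ} (hD : Dᵀ = D) :
    symLog (NormedSpace.exp D) = D :=
  CFC.log_exp D (isSelfAdjoint_of_transpose_eq hD)

open scoped Matrix.Norms.L2Operator in
theorem exp_symLog {p : ℕ} (S : SPD p) : NormedSpace.exp (symLog S.1) = S.1 := by
  have hS : IsSelfAdjoint S.1 := S.2.isHermitian
  have hf : (spectrum ℝ S.1).Finite := Matrix.finite_spectrum _
  rw [symLog, ← CFC.real_exp_eq_normedSpace_exp (cfc_predicate _ _),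
    ← cfc_comp Real.exp Real.log _ hS ((hf.image _).continuousOn _) (hf.continuousOn _)]
  conv_rhs => rw [← cfc_id ℝ S.1 hS]
  apply cfc_congr
  intro x hx
  exact Real.exp_log (pos_of_mem_spectrum S hx)

theorem symSqrt_transpose {p : ℕ} (S : Matrix (Fin p) (Fin p) ℝ) : (symSqrt S)ᵀ = symSqrt S := by
  have h : IsSelfAdjoint (cfc Real.sqrt S) := cfc_predicate _ _
  simpa [symSqrt, IsSelfAdjoint, star_eq_conjTranspose] using h

theorem det_symSqrt_ne_zero {p : ℕ} (P : SPD p) : (symSqrt P.1).det ≠ 0 := by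
  intro h0
  have h := (symSqrt_conj_posDef P P).det_pos
  rw [Matrix.det_mul, h0, mul_zero] at h
  exact lt_irrefl _ h

/-- Uniqueness of the Cholesky factor. -/
theorem IsPosLower.eq_of_mul_transpose_eq {p : ℕ} {L K : Matrix (Fin p) (Fin p) ℝ}
    (hL : IsPosLower L) (hK : IsPosLower K) (h : L * Lᵀ = K * Kᵀ) : L = K := by
  have hLu : IsUnit L.det := hL.det_ne_zero.isUnit
  have hKu : IsUnit K.det := hK.det_ne_zero.isUnit
  have hKl : K.IsLowerTriangular := fun i j hij => hK.1 i j hij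
  have hLl : L.IsLowerTriangular := fun i j hij => hL.1 i j hij
  have : Invertible K := Matrix.invertibleOfIsUnitDet K hKu
  have hKi : (K⁻¹).IsLowerTriangular := Matrix.blockTriangular_inv_of_blockTriangular hKl
  -- The quotient M = K⁻¹L is lower triangular and orthogonal, so M⁻¹ = Mᵀ is lower triangular too
  -- and M is diagonal. Its diagonal entries are positive with square 1.
  obtain ⟨M, hKM, hMl⟩ : ∃ M, K * M = L ∧ M.IsLowerTriangular :=
    ⟨K⁻¹ * L, Matrix.mul_nonsing_inv_cancel_left _ _ hKu, Matrix.BlockTriangular.mul hKi hLl⟩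
  have hMM : M * Mᵀ = 1 := by
    have : K * (M * Mᵀ) * Kᵀ = K * Kᵀ := by
      rw [← h, ← hKM, Matrix.transpose_mul]
      simp only [Matrix.mul_assoc]
    have hKt : IsUnit (Kᵀ).det := by rwa [Matrix.det_transpose]
    have h2 := congrArg (fun A => K⁻¹ * (A * (Kᵀ)⁻¹)) this
    simpa only [Matrix.mul_assoc, Matrix.mul_nonsing_inv _ hKt, Matrix.mul_one,
      Matrix.nonsing_inv_mul_cancel_left _ _ hKu, Matrix.nonsing_inv_mul _ hKu] using h2
  have hMu : IsUnit M.det := by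
    rw [← Matrix.isUnit_iff_isUnit_det]
    exact ⟨⟨M, Mᵀ, hMM, mul_eq_one_comm.mp hMM⟩, rfl⟩
  have : Invertible M := Matrix.invertibleOfIsUnitDet M hMu
  have hMi : (M⁻¹).IsLowerTriangular := Matrix.blockTriangular_inv_of_blockTriangular hMl
  rw [Matrix.inv_eq_right_inv hMM] at hMi
  have hdiag : ∀ i j, i ≠ j → M i j = 0 := by
    intro i j hij
    rcases lt_or_gt_of_ne hij with h1 | h1
    · exact hMl h1
    · exact hMi h1
  have hLM : ∀ i j, L i j = K i j * M j j := by
    intro i j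
    rw [← hKM, Matrix.mul_apply, Finset.sum_eq_single j]
    · intro b _ hb
      rw [hdiag b j hb, mul_zero]
    · simp
  have hone : ∀ i, M i i = 1 := by
    intro i
    have h1 : M i i * M i i = 1 := by
      have := congrFun (congrFun hMM i) i
      rw [Matrix.mul_apply, Finset.sum_eq_single i] at this
      · simpa using this
      · intro b _ hb
        rw [hdiag i b hb.symm, zero_mul]
      · simp
    have h2 : 0 < M i i := by
      have := hL.2 i
      rw [hLM i i] at this
      exact pos_of_mul_pos_right this (hK.2 i).le
    nlinarith
  ext i j
  rw [hLM, hone, mul_one]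

theorem cholesky_eq {p : ℕ} {L : Matrix (Fin p) (Fin p) ℝ} (hL : IsPosLower L) {S : SPD p}
    (hS : S.1 = L * Lᵀ) : cholesky S = L :=
  (cholesky_spec S).1.eq_of_mul_transpose_eq hL ((cholesky_spec S).2.symm.trans hS)

theorem IsPosLower.eq_parts {p : ℕ} {L : Matrix (Fin p) (Fin p) ℝ} (hL : IsPosLower L) :
    L = strictLower L + Matrix.diagonal (fun i => L i i) := by
  ext i j
  rcases lt_trichotomy i j with h | h | h
  · simp [strictLower, h.not_gt, h.ne, hL.1 i j h]
  · subst h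
    simp [strictLower]
  · simp [strictLower, h, h.ne']

theorem strictLower_strictLower_add_diagonal {p : ℕ} (Y : Matrix (Fin p) (Fin p) ℝ)
    (d : Fin p → ℝ) : strictLower (strictLower Y + Matrix.diagonal d) = strictLower Y := by
  ext i j
  by_cases h : j < i
  · simp [strictLower, h, h.ne']
  · simp [strictLower, h]

theorem strictLower_add_diagonal_apply_self {p : ℕ} (Y : Matrix (Fin p) (Fin p) ℝ)
    (d : Fin p → ℝ) (i : Fin p) : (strictLower Y + Matrix.diagonal d) i i = d i := by
  simp [strictLower]

theorem strictLower_add {p : ℕ} (Y Z : Matrix (Fin p) (Fin p) ℝ) :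
    strictLower (Y + Z) = strictLower Y + strictLower Z := by
  ext i j
  by_cases h : j < i <;> simp [strictLower, h]

theorem exists_cholesky_eq {p : ℕ} (Y : Matrix (Fin p) (Fin p) ℝ) (d : Fin p → ℝ)
    (hd : ∀ i, 0 < d i) : ∃ S : SPD p, cholesky S = strictLower Y + Matrix.diagonal d := by
  have h := IsPosLower.of_parts Y d hd
  exact ⟨⟨_, posDef_mul_transpose h.det_ne_zero⟩, cholesky_eq h rfl⟩

theorem spdAdd_surjective {p : ℕ} (g : SPDMetric p) (P : SPD p) :
    Function.Surjective (spdAdd g P) := by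
  intro S
  cases g with
  | ai β hβ =>
    have hu : IsUnit (symSqrt P.1).det := (det_symSqrt_ne_zero P).isUnit
    have hi : ((symSqrt P.1)⁻¹)ᵀ = (symSqrt P.1)⁻¹ := by
      rw [Matrix.transpose_nonsing_inv, symSqrt_transpose]
    have hiu : IsUnit (symSqrt P.1)⁻¹ := by
      rw [Matrix.isUnit_iff_isUnit_det]
      exact Matrix.isUnit_nonsing_inv_det _ hu
    have hQ : ((symSqrt P.1)⁻¹ * S.1 * (symSqrt P.1)⁻¹).PosDef := by
      have := S.2.mul_mul_conjTranspose_same (Matrix.vecMul_injective_of_isUnit hiu)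
      rwa [Matrix.conjTranspose_eq_transpose_of_trivial, hi] at this
    refine ⟨⟨_, hQ⟩, Subtype.ext ?_⟩
    change symSqrt P.1 * ((symSqrt P.1)⁻¹ * S.1 * (symSqrt P.1)⁻¹) * symSqrt P.1 = S.1
    rw [Matrix.mul_assoc, Matrix.mul_assoc ((symSqrt P.1)⁻¹ * S.1),
      Matrix.nonsing_inv_mul _ hu, Matrix.mul_one, Matrix.mul_nonsing_inv_cancel_left _ _ hu]
  | le =>
    have ht : (symLog S.1 - symLog P.1)ᵀ = symLog S.1 - symLog P.1 := by
      rw [Matrix.transpose_sub, symLog_transpose, symLog_transpose]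
    refine ⟨⟨NormedSpace.exp (symLog S.1 - symLog P.1), posDef_exp ht⟩, Subtype.ext ?_⟩
    change NormedSpace.exp (symLog P.1 + symLog (NormedSpace.exp (symLog S.1 - symLog P.1))) = S.1
    rw [symLog_exp ht, add_sub_cancel, exp_symLog]
  | lc =>
    obtain ⟨Q, hQ⟩ := exists_cholesky_eq (cholesky S - cholesky P)
      (fun i => cholesky S i i / cholesky P i i)
      (fun i => div_pos ((cholesky_spec S).1.2 i) ((cholesky_spec P).1.2 i))
    have hK : strictLower (cholesky P + cholesky Q)
        + Matrix.diagonal (fun i => cholesky P i i * cholesky Q i i) = cholesky S := by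
      conv_rhs => rw [(cholesky_spec S).1.eq_parts]
      congr 1
      · rw [strictLower_add, hQ, strictLower_strictLower_add_diagonal, ← strictLower_add,
          add_sub_cancel]
      · congr 1
        funext i
        rw [hQ, strictLower_add_diagonal_apply_self,
          mul_div_cancel₀ _ ((cholesky_spec P).1.2 i).ne']
    refine ⟨Q, Subtype.ext ?_⟩
    rw [(cholesky_spec S).2, ← hK]
    rfl

theorem spdLog_transpose {p : ℕ} (g : SPDMetric p) (S : SPD p) :
    (spdLog g S)ᵀ = spdLog g S := by
  cases g with
  | ai β hβ => exact symLog_transpose _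
  | le => exact symLog_transpose _
  | lc => simp only [spdLog, Matrix.transpose_add, Matrix.transpose_transpose, add_comm]

theorem exists_spdLog_eq {p : ℕ} (g : SPDMetric p) {D : Matrix (Fin p) (Fin p) ℝ}
    (hD : Dᵀ = D) : ∃ S : SPD p, spdLog g S = D := by
  cases g with
  | ai β hβ => exact ⟨⟨NormedSpace.exp D, posDef_exp hD⟩, symLog_exp hD⟩
  | le => exact ⟨⟨NormedSpace.exp D, posDef_exp hD⟩, symLog_exp hD⟩
  | lc =>
    -- In T + Tᵀ the diagonal of T is counted twice, hence the half.
    obtain ⟨S, hS⟩ := exists_cholesky_eq D (fun i => Real.exp (D i i / 2))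
      (fun i => Real.exp_pos _)
    refine ⟨S, ?_⟩
    simp only [spdLog]
    rw [hS, strictLower_strictLower_add_diagonal]
    simp only [strictLower_add_diagonal_apply_self, Real.log_exp]
    ext i j
    have hij : D j i = D i j := congrFun (congrFun hD i) j
    rcases lt_trichotomy i j with h | h | h
    · simp [strictLower, h.not_gt, h.ne, h, hij]
    · subst h
      simp [strictLower]
    · simp [strictLower, h.not_gt, h, h.ne']

theorem halfLower_add {p : ℕ} (V W : Matrix (Fin p) (Fin p) ℝ) :
    halfLower (V + W) = halfLower V + halfLower W := by
  rw [halfLower, halfLower, halfLower, strictLower_add, add_add_add_comm,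
    Matrix.diagonal_add]
  simp [add_div]

theorem halfLower_smul {p : ℕ} (c : ℝ) (V : Matrix (Fin p) (Fin p) ℝ) :
    halfLower (c • V) = c • halfLower V := by
  ext i j
  by_cases h : j < i
  · simp [halfLower, strictLower, h, h.ne']
  · rcases eq_or_ne i j with rfl | h2
    · simp [halfLower, strictLower, mul_div_assoc]
    · simp [halfLower, strictLower, h, h2]

theorem spdMetricAtOne_add_left {p : ℕ} (g : SPDMetric p) (U V W : Matrix (Fin p) (Fin p) ℝ) :
    spdMetricAtOne g (U + V) W = spdMetricAtOne g U W + spdMetricAtOne g V W := by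
  cases g <;> simp only [spdMetricAtOne, Matrix.add_mul, Matrix.trace_add, halfLower_add,
    Matrix.transpose_add]
  ring

theorem spdMetricAtOne_smul_left {p : ℕ} (g : SPDMetric p) (c : ℝ)
    (V W : Matrix (Fin p) (Fin p) ℝ) :
    spdMetricAtOne g (c • V) W = c * spdMetricAtOne g V W := by
  cases g <;> simp only [spdMetricAtOne, Matrix.smul_mul, Matrix.trace_smul, halfLower_smul,
    Matrix.transpose_smul, smul_eq_mul]
  ring

theorem trace_transpose_mul_comm {m n : ℕ} (A B : Matrix (Fin m) (Fin n) ℝ) :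
    (Aᵀ * B).trace = (Bᵀ * A).trace := by
  rw [← Matrix.trace_transpose, Matrix.transpose_mul, Matrix.transpose_transpose]

theorem trace_transpose_mul_self_nonneg {m n : ℕ} (A : Matrix (Fin m) (Fin n) ℝ) :
    0 ≤ (Aᵀ * A).trace := by
  simp only [Matrix.trace, Matrix.diag, Matrix.mul_apply, Matrix.transpose_apply]
  exact Finset.sum_nonneg fun i _ => Finset.sum_nonneg fun j _ => mul_self_nonneg _

theorem spdMetricAtOne_comm {p : ℕ} (g : SPDMetric p) (V W : Matrix (Fin p) (Fin p) ℝ) :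
    spdMetricAtOne g V W = spdMetricAtOne g W V := by
  cases g with
  | ai β hβ => simp only [spdMetricAtOne, Matrix.trace_mul_comm V W]; ring
  | le => simp only [spdMetricAtOne, Matrix.trace_mul_comm V W]
  | lc => exact trace_transpose_mul_comm _ _

/-- Cauchy–Schwarz on the diagonal. This is where the bound -1/p for β comes from. -/
theorem trace_sq_le {p : ℕ} (V : Matrix (Fin p) (Fin p) ℝ) :
    V.trace ^ 2 ≤ p * (Vᵀ * V).trace := by
  have h1 : V.trace ^ 2 ≤ p * ∑ i, V i i ^ 2 := by
    simpa [Matrix.trace] using sq_sum_le_card_mul_sum_sq (s := Finset.univ) (f := fun i => V i i)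
  refine h1.trans (mul_le_mul_of_nonneg_left ?_ (Nat.cast_nonneg p))
  simp only [Matrix.trace, Matrix.diag, Matrix.mul_apply, Matrix.transpose_apply, ← sq]
  exact Finset.sum_le_sum fun i _ =>
    Finset.single_le_sum (f := fun j => V j i ^ 2) (fun j _ => sq_nonneg _) (Finset.mem_univ i)

theorem spdMetricAtOne_self_nonneg {p : ℕ} (g : SPDMetric p) {V : Matrix (Fin p) (Fin p) ℝ}
    (hV : Vᵀ = V) : 0 ≤ spdMetricAtOne g V V := by
  cases g with
  | ai β hβ =>
    have h1 := trace_sq_le V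
    have h2 := trace_transpose_mul_self_nonneg V
    rw [hV] at h1 h2
    simp only [spdMetricAtOne, ← sq V.trace]
    rcases Nat.eq_zero_or_pos p with rfl | hp
    · simp [Matrix.trace]
    · have hp' : (0 : ℝ) < p := Nat.cast_pos.mpr hp
      have h3 : -(1 / (p : ℝ)) * V.trace ^ 2 ≤ β * V.trace ^ 2 :=
        mul_le_mul_of_nonneg_right hβ.le (sq_nonneg _)
      have h4 : 1 / (p : ℝ) * V.trace ^ 2 ≤ (V * V).trace := by
        rw [one_div_mul_eq_div, div_le_iff₀ hp']
        linarith
      linarith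
  | le =>
    have h2 := trace_transpose_mul_self_nonneg V
    rwa [hV] at h2
  | lc => exact trace_transpose_mul_self_nonneg _

/-- The functional calculus preserves intertwining relations. -/
theorem cfc_mul_eq_mul_cfc {p : ℕ} (f : ℝ → ℝ) {A B M : Matrix (Fin p) (Fin p) ℝ}
    (hA : Aᵀ = A) (hB : Bᵀ = B) (h : A * M = M * B) : cfc f A * M = M * cfc f B := by
  have hA' := isSelfAdjoint_of_transpose_eq hA
  have hB' := isSelfAdjoint_of_transpose_eq hB
  have hf : (spectrum ℝ A ∪ spectrum ℝ B).Finite :=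
    (Matrix.finite_spectrum A).union (Matrix.finite_spectrum B)
  -- A single polynomial agrees with f on both finite spectra, and polynomials preserve
  -- intertwining.
  let q := Lagrange.interpolate hf.toFinset id f
  have hq : ∀ x ∈ spectrum ℝ A ∪ spectrum ℝ B, q.eval x = f x := fun x hx =>
    Lagrange.eval_interpolate_at_node (v := id) f Function.injective_id.injOn
      (hf.mem_toFinset.mpr hx)
  have h1 : cfc f A = Polynomial.aeval A q := by
    rw [← cfc_polynomial q A hA']
    exact cfc_congr fun x hx => (hq x (Or.inl hx)).symm
  have h2 : cfc f B = Polynomial.aeval B q := by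
    rw [← cfc_polynomial q B hB']
    exact cfc_congr fun x hx => (hq x (Or.inr hx)).symm
  rw [h1, h2]
  clear_value q
  clear hq h1 h2
  induction q using Polynomial.induction_on' with
  | add r s hr hs => rw [map_add, map_add, add_mul, mul_add, hr, hs]
  | monomial k c =>
    have hk : A ^ k * M = M * B ^ k := SemiconjBy.pow_right (a := M) (x := B) (y := A) h.symm k
      |>.symm
    simp only [Polynomial.aeval_monomial, Algebra.algebraMap_eq_smul_one, smul_mul_assoc, one_mul,
      mul_smul_comm, hk]

theorem symLog_inv {p : ℕ} (S : SPD p) : symLog (S.1)⁻¹ = -symLog S.1 := by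
  have h : (S.1)⁻¹ = NormedSpace.exp (-symLog S.1) := by
    conv_lhs => rw [← exp_symLog S]
    rw [Matrix.exp_neg]
  rw [h, symLog_exp (by rw [Matrix.transpose_neg, symLog_transpose])]

theorem symSqrt_mul_self {p : ℕ} (P : SPD p) : symSqrt P.1 * symSqrt P.1 = P.1 := by
  have hP : IsSelfAdjoint P.1 := P.2.isHermitian
  rw [symSqrt, ← cfc_mul Real.sqrt Real.sqrt P.1]
  conv_rhs => rw [← cfc_id ℝ P.1 hP]
  exact cfc_congr fun x hx => Real.mul_self_sqrt (pos_of_mem_spectrum P hx).le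

theorem spd_transpose {p : ℕ} (P : SPD p) : (P.1)ᵀ = P.1 := by
  simpa using P.2.isHermitian.eq

theorem isUnit_det_spd {p : ℕ} (P : SPD p) : IsUnit (P.1).det := P.2.det_pos.ne'.isUnit

/-- For the affine-invariant operations, the logarithms of `⊖X ⊕ P` and of `⊖P ⊕ X` are similar
up to the sign. -/
theorem exists_symLog_spdAdd_ai_conj {p : ℕ} (β : ℝ) (hβ : -(1 / (p : ℝ)) < β) (P X : SPD p) :
    ∃ M : Matrix (Fin p) (Fin p) ℝ, IsUnit M.det ∧
      -symLog (spdAdd (.ai β hβ) (spdNeg (.ai β hβ) X) P).1 * M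
        = M * symLog (spdAdd (.ai β hβ) (spdNeg (.ai β hβ) P) X).1 := by
  set A := spdAdd (.ai β hβ) (spdNeg (.ai β hβ) X) P with hA
  set B := spdAdd (.ai β hβ) (spdNeg (.ai β hβ) P) X with hB
  set Xi : SPD p := ⟨(X.1)⁻¹, X.2.inv⟩
  set Pi : SPD p := ⟨(P.1)⁻¹, P.2.inv⟩
  set a := symSqrt Xi.1
  set b := symSqrt Pi.1
  have hAa : A.1 = a * P.1 * a := rfl
  have hBb : B.1 = b * X.1 * b := rfl
  have haX : a * a * X.1 = 1 := by
    rw [symSqrt_mul_self Xi]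
    exact Matrix.nonsing_inv_mul _ (isUnit_det_spd X)
  have hPb : P.1 * (b * b) = 1 := by
    rw [symSqrt_mul_self Pi]
    exact Matrix.mul_nonsing_inv _ (isUnit_det_spd P)
  -- Here a = X^(-1/2), b = P^(-1/2), A = aPa and B = bXb. The matrix M = aXb satisfies AMB = M, so
  -- it intertwines A⁻¹ with B, and log A⁻¹ = -log A with log B.
  have hM : A.1 * (a * X.1 * b) * B.1 = a * X.1 * b := by
    have e1 : A.1 * (a * X.1 * b) * B.1
        = a * (P.1 * (a * a * X.1) * (b * b)) * X.1 * b := by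
      rw [hAa, hBb]; simp only [Matrix.mul_assoc]
    rw [e1, haX, Matrix.mul_one, hPb, Matrix.mul_one]
  refine ⟨a * X.1 * b, ?_, ?_⟩
  · rw [Matrix.det_mul, Matrix.det_mul]
    exact ((det_symSqrt_ne_zero Xi).isUnit.mul (isUnit_det_spd X)).mul
      (det_symSqrt_ne_zero Pi).isUnit
  · rw [← symLog_inv]
    refine cfc_mul_eq_mul_cfc Real.log ?_ (spd_transpose B) ?_
    · rw [Matrix.transpose_nonsing_inv, spd_transpose]
    · conv_lhs => rw [← hM]
      rw [Matrix.mul_assoc, Matrix.nonsing_inv_mul_cancel_left _ _ (isUnit_det_spd A)]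

theorem strictLower_neg {p : ℕ} (Y : Matrix (Fin p) (Fin p) ℝ) :
    strictLower (-Y) = -strictLower Y := by
  ext i j
  by_cases h : j < i <;> simp [strictLower, h]

theorem cholesky_spdNeg_lc {p : ℕ} (P : SPD p) : cholesky (spdNeg .lc P)
    = strictLower (-cholesky P) + Matrix.diagonal (fun i => (cholesky P i i)⁻¹) :=
  cholesky_eq (IsPosLower.of_parts _ _ fun i => inv_pos.mpr ((cholesky_spec P).1.2 i)) rfl

theorem cholesky_spdAdd_lc {p : ℕ} (P Q : SPD p) : cholesky (spdAdd .lc P Q)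
    = strictLower (cholesky P + cholesky Q)
      + Matrix.diagonal (fun i => cholesky P i i * cholesky Q i i) :=
  cholesky_eq (IsPosLower.of_parts _ _ fun i =>
    mul_pos ((cholesky_spec P).1.2 i) ((cholesky_spec Q).1.2 i)) rfl

theorem spdLog_diff_lc {p : ℕ} (P Q : SPD p) :
    spdLog .lc (spdAdd .lc (spdNeg .lc P) Q) = spdLog .lc Q - spdLog .lc P := by
  have hd : (fun i => Real.log (cholesky (spdAdd .lc (spdNeg .lc P) Q) i i))
      = fun i => Real.log (cholesky Q i i) - Real.log (cholesky P i i) := by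
    funext i
    rw [cholesky_spdAdd_lc, strictLower_add_diagonal_apply_self, cholesky_spdNeg_lc,
      strictLower_add_diagonal_apply_self, Real.log_mul
        (inv_pos.mpr ((cholesky_spec P).1.2 i)).ne' ((cholesky_spec Q).1.2 i).ne', Real.log_inv]
    ring
  have hl : strictLower (cholesky (spdAdd .lc (spdNeg .lc P) Q))
      = strictLower (cholesky Q) - strictLower (cholesky P) := by
    rw [cholesky_spdAdd_lc, strictLower_strictLower_add_diagonal, strictLower_add,
      cholesky_spdNeg_lc, strictLower_strictLower_add_diagonal, strictLower_neg]
    abel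
  simp only [spdLog]
  rw [hd, hl, ← Matrix.diagonal_sub]
  simp only [Matrix.transpose_add, Matrix.transpose_sub]
  abel

theorem spdLog_diff_le {p : ℕ} (P Q : SPD p) :
    spdLog .le (spdAdd .le (spdNeg .le P) Q) = spdLog .le Q - spdLog .le P := by
  change symLog (NormedSpace.exp (symLog (P.1)⁻¹ + symLog Q.1)) = symLog Q.1 - symLog P.1
  rw [symLog_inv, symLog_exp]
  · abel
  · rw [Matrix.transpose_add, Matrix.transpose_neg, symLog_transpose, symLog_transpose]

theorem spdMetricAtOne_neg_neg {p : ℕ} (g : SPDMetric p) (V : Matrix (Fin p) (Fin p) ℝ) :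
    spdMetricAtOne g (-V) (-V) = spdMetricAtOne g V V := by
  rw [← neg_one_smul ℝ V, spdMetricAtOne_smul_left, spdMetricAtOne_comm,
    spdMetricAtOne_smul_left]
  ring

/-- In the affine-invariant case the norm depends only on the traces of the logarithm and of its
square, which similarity preserves. For the other two metrics both sides come from opposite
differences of logarithms. -/
theorem spdInner_diff_comm {p : ℕ} (g : SPDMetric p) (P X : SPD p) :
    spdInner g (spdAdd g (spdNeg g P) X) (spdAdd g (spdNeg g P) X)
      = spdInner g (spdAdd g (spdNeg g X) P) (spdAdd g (spdNeg g X) P) := by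
  cases g with
  | ai β hβ =>
    obtain ⟨M, hM, h⟩ := exists_symLog_spdAdd_ai_conj β hβ P X
    simp only [spdInner, spdLog]
    rw [← spdMetricAtOne_neg_neg _ (symLog (spdAdd _ (spdNeg _ X) P).1)]
    generalize symLog (spdAdd _ (spdNeg _ P) X).1 = C at h ⊢
    generalize -symLog (spdAdd _ (spdNeg _ X) P).1 = D at h ⊢
    have hD : D = M * C * M⁻¹ := by
      rw [← h, Matrix.mul_nonsing_inv_cancel_right _ _ hM]
    have hDD : D * D = M * (C * C) * M⁻¹ := by
      rw [hD]
      simp only [Matrix.mul_assoc]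
      rw [Matrix.nonsing_inv_mul_cancel_left _ _ hM]
    have hc : ∀ Z : Matrix (Fin p) (Fin p) ℝ, (M * Z * M⁻¹).trace = Z.trace := by
      intro Z
      rw [Matrix.trace_mul_comm, Matrix.nonsing_inv_mul_cancel_left _ _ hM]
    simp only [spdMetricAtOne]
    rw [hDD, hc, hD, hc]
  | le =>
    simp only [spdInner, spdLog_diff_le]
    rw [← neg_sub, spdMetricAtOne_neg_neg]
  | lc =>
    simp only [spdInner, spdLog_diff_lc]
    rw [← neg_sub, spdMetricAtOne_neg_neg]

end PositiveDefinite

/-! ### Angles with a hyperplane for a positive semidefinite form -/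

section SemiInner

variable {E : Type*} [AddCommGroup E] [Module ℝ E]

/-- The cosine of the angle between two vectors for a positive semidefinite form. -/
noncomputable def formCos (B : LinearMap.BilinForm ℝ E) (v x : E) : ℝ :=
  B v x / (Real.sqrt (B v v) * Real.sqrt (B x x))

theorem formCos_comm {B : LinearMap.BilinForm ℝ E} (hs : ∀ x y, B x y = B y x) (v x : E) :
    formCos B v x = formCos B x v := by
  rw [formCos, formCos, hs v x, mul_comm (Real.sqrt _)]

theorem form_sq_le {B : LinearMap.BilinForm ℝ E} (hs : ∀ x y, B x y = B y x)
    (hp : ∀ x, 0 ≤ B x x) (v x : E) : B v x ^ 2 ≤ B v v * B x x := by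
  have h : ∀ t : ℝ, 0 ≤ B v v * (t * t) + 2 * B v x * t + B x x := by
    intro t
    have := hp (t • v + x)
    simp only [map_add, map_smul, LinearMap.add_apply, LinearMap.smul_apply, smul_eq_mul,
      hs x v] at this
    linarith
  have := discrim_le_zero h
  rw [discrim] at this
  linarith

theorem abs_form_le {B : LinearMap.BilinForm ℝ E} (hs : ∀ x y, B x y = B y x)
    (hp : ∀ x, 0 ≤ B x x) (v x : E) : |B v x| ≤ Real.sqrt (B v v) * Real.sqrt (B x x) := by
  rw [← Real.sqrt_mul (hp v)]
  exact Real.abs_le_sqrt (form_sq_le hs hp v x)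

theorem abs_formCos_le_one {B : LinearMap.BilinForm ℝ E} (hs : ∀ x y, B x y = B y x)
    (hp : ∀ x, 0 ≤ B x x) (v x : E) : |formCos B v x| ≤ 1 := by
  rw [formCos, abs_div, abs_of_nonneg (mul_nonneg (Real.sqrt_nonneg _) (Real.sqrt_nonneg _))]
  exact div_le_one_of_le₀ (abs_form_le hs hp v x)
    (mul_nonneg (Real.sqrt_nonneg _) (Real.sqrt_nonneg _))

theorem cos_arccos_formCos {B : LinearMap.BilinForm ℝ E} (hs : ∀ x y, B x y = B y x)
    (hp : ∀ x, 0 ≤ B x x) (v x : E) : Real.cos (Real.arccos (formCos B v x)) = formCos B v x := by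
  have := abs_le.mp (abs_formCos_le_one hs hp v x)
  exact Real.cos_arccos this.1 this.2

/-- The largest cosine of an angle between a vector `x` with `B x w ≠ 0` and a vector orthogonal
to `w`: it is attained along a ray, and the sine of the corresponding angle gives the distance
from `x` to the hyperplane. -/
theorem exists_formCos_max {B : LinearMap.BilinForm ℝ E} (hs : ∀ x y, B x y = B y x)
    (hp : ∀ x, 0 ≤ B x x) {x w u₀ : E} (hw : 0 < B w w) (hxw : B x w ≠ 0) (hu₀ : u₀ ≠ 0)
    (hu₀w : B u₀ w = 0) :
    ∃ m : ℝ, (∀ v, B v w = 0 → formCos B v x ≤ m)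
      ∧ (∃ u, u ≠ 0 ∧ B u w = 0 ∧ ∀ t : ℝ, 0 < t → formCos B (t • u) x = m)
      ∧ Real.sqrt (1 - m ^ 2) * Real.sqrt (B x x) = |B x w| / Real.sqrt (B w w) := by
  have hx : 0 < B x x := by
    have h1 := form_sq_le hs hp x w
    have h2 : 0 < B x w ^ 2 := by positivity
    by_contra h3
    have h4 : B x x = 0 := le_antisymm (not_lt.mp h3) (hp x)
    rw [h4, zero_mul] at h1
    linarith
  -- The component of x orthogonal to w: on the hyperplane, pairing with x equals pairing with y.
  set y := x - (B x w / B w w) • w with hy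
  have hyw : B y w = 0 := by
    simp only [hy, map_sub, map_smul, LinearMap.sub_apply, LinearMap.smul_apply, smul_eq_mul]
    field_simp
    ring
  have hvx : ∀ v, B v w = 0 → B v x = B v y := by
    intro v hv
    simp only [hy, map_sub, map_smul, smul_eq_mul, hv, mul_zero, sub_zero]
  have hyy : B y y = B x x - B x w ^ 2 / B w w := by
    rw [← hvx y hyw]
    simp only [hy, map_sub, map_smul, LinearMap.sub_apply, LinearMap.smul_apply, smul_eq_mul,
      hs w x]
    ring
  have hsx : 0 < Real.sqrt (B x x) := Real.sqrt_pos.mpr hx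
  refine ⟨Real.sqrt (B y y) / Real.sqrt (B x x), fun v hv => ?_, ?_, ?_⟩
  · rw [formCos, hvx v hv, ← div_div]
    refine div_le_div_of_nonneg_right ?_ hsx.le
    -- Also covers isotropic v, whose cosine is 0 by the convention on division.
    refine div_le_of_le_mul₀ (Real.sqrt_nonneg _) (Real.sqrt_nonneg _) ?_
    rw [mul_comm]
    exact (le_abs_self _).trans (abs_form_le hs hp v y)
  -- If y is isotropic, everything on the hyperplane is orthogonal to x, so m = 0 and `u₀` attains
  -- it; otherwise y itself does.
  · rcases (hp y).eq_or_lt with h0 | h0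
    · refine ⟨u₀, hu₀, hu₀w, fun t _ => ?_⟩
      have h1 : B (t • u₀) w = 0 := by simp [hu₀w]
      have h2 := abs_form_le hs hp (t • u₀) y
      rw [← h0, Real.sqrt_zero, mul_zero] at h2
      rw [formCos, hvx _ h1, abs_nonpos_iff.mp h2, ← h0]
      simp
    · refine ⟨y, fun h => ?_, hyw, fun t ht => ?_⟩
      · rw [h] at h0
        simp at h0
      · have h1 : B (t • y) (t • y) = t ^ 2 * B y y := by
          simp only [map_smul, LinearMap.smul_apply, smul_eq_mul]
          ring
        rw [formCos, h1, Real.sqrt_mul (sq_nonneg t), Real.sqrt_sq ht.le, map_smul,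
          LinearMap.smul_apply, smul_eq_mul, hvx y hyw]
        have h2 : 0 < Real.sqrt (B y y) := Real.sqrt_pos.mpr h0
        rw [div_eq_div_iff (by positivity) hsx.ne']
        have h3 := Real.mul_self_sqrt h0.le
        linear_combination (-(t * Real.sqrt (B x x))) * h3
  · rw [← Real.sqrt_mul' _ hx.le, div_pow, Real.sq_sqrt (hp y), Real.sq_sqrt hx.le, sub_mul,
      div_mul_cancel₀ _ hx.ne', hyy, one_mul, sub_sub_cancel, Real.sqrt_div (sq_nonneg _),
      Real.sqrt_sq_eq_abs]

/-- A linear functional on a plane has a nontrivial kernel. -/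
theorem exists_ne_zero_form_eq_zero (B : LinearMap.BilinForm ℝ E) (w : E) {e f : E}
    (h : ∀ a b : ℝ, a • e + b • f = 0 → a = 0 ∧ b = 0) : ∃ u, u ≠ 0 ∧ B u w = 0 := by
  by_cases he : B e w = 0
  · refine ⟨e, fun h0 => ?_, he⟩
    have := (h 1 0 (by simp [h0])).1
    exact one_ne_zero this
  · refine ⟨B f w • e + (-B e w) • f, fun h0 => he (neg_eq_zero.mp (h _ _ h0).2), ?_⟩
    simp only [map_add, map_smul, LinearMap.add_apply, LinearMap.smul_apply, smul_eq_mul]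
    ring

end SemiInner

/-! ### The structure space: linearization and existence of maximizers -/

section StructureSpace

/-- The symmetric matrices. -/
def symMatrices (p : ℕ) : Submodule ℝ (Matrix (Fin p) (Fin p) ℝ) where
  carrier := {D | Dᵀ = D}
  add_mem' := fun {A B} hA hB => by
    change (A + B)ᵀ = A + B
    rw [Matrix.transpose_add, hA, hB]
  zero_mem' := Matrix.transpose_zero
  smul_mem' := fun c A hA => by
    change (c • A)ᵀ = c • A
    rw [Matrix.transpose_smul, hA]

/-- The tangent space of the structure space at the base point. -/
abbrev structTangent (n p : ℕ) := grTangent n p × symMatrices p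

/-- The Riemannian metric of the structure space at the base point. -/
noncomputable def structForm (n : ℕ) {p : ℕ} (lam : ℝ) (g : SPDMetric p) :
    LinearMap.BilinForm ℝ (structTangent n p) :=
  LinearMap.mk₂ ℝ (fun v w => lam * (1 / 2 * ((v.1.1)ᵀ * w.1.1).trace)
      + spdMetricAtOne g v.2.1 w.2.1)
    (fun u v w => by
      simp only [Prod.fst_add, Prod.snd_add, Submodule.coe_add, Matrix.transpose_add,
        Matrix.add_mul, Matrix.trace_add, spdMetricAtOne_add_left]
      ring)
    (fun c v w => by
      simp only [Prod.smul_fst, Prod.smul_snd, Submodule.coe_smul, Matrix.transpose_smul,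
        Matrix.smul_mul, Matrix.trace_smul, spdMetricAtOne_smul_left, smul_eq_mul]
      ring)
    (fun u v w => by
      simp only [Prod.fst_add, Prod.snd_add, Submodule.coe_add, Matrix.mul_add,
        Matrix.trace_add, spdMetricAtOne_comm g u.2.1, spdMetricAtOne_add_left]
      ring)
    (fun c v w => by
      simp only [Prod.smul_fst, Prod.smul_snd, Submodule.coe_smul, Matrix.mul_smul,
        Matrix.trace_smul, spdMetricAtOne_comm g v.2.1, spdMetricAtOne_smul_left, smul_eq_mul]
      ring)

theorem structForm_apply {n p : ℕ} (lam : ℝ) (g : SPDMetric p) (v w : structTangent n p) :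
    structForm n lam g v w = lam * (1 / 2 * ((v.1.1)ᵀ * w.1.1).trace)
      + spdMetricAtOne g v.2.1 w.2.1 := rfl

theorem structForm_comm {n p : ℕ} (lam : ℝ) (g : SPDMetric p) (v w : structTangent n p) :
    structForm n lam g v w = structForm n lam g w v := by
  rw [structForm_apply, structForm_apply, trace_transpose_mul_comm, spdMetricAtOne_comm]

theorem structForm_self_nonneg {n p : ℕ} {lam : ℝ} (hlam : 0 < lam) (g : SPDMetric p)
    (v : structTangent n p) : 0 ≤ structForm n lam g v v := by
  have h1 := trace_transpose_mul_self_nonneg v.1.1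
  have h2 := spdMetricAtOne_self_nonneg g v.2.2
  rw [structForm_apply]
  positivity

/-- The logarithm at the base point of the structure space. -/
noncomputable def structLog {n p : ℕ} (g : SPDMetric p) (Q : StructureSpace n p)
    (hQ : OffCut (baseProj n p) (tau Q.1)) : structTangent n p :=
  (⟨grLog (baseProj n p) (tau Q.1), grLog_mem_grTangent hQ⟩,
    ⟨spdLog g Q.2, spdLog_transpose g Q.2⟩)

theorem psdDiff_surjective {n p : ℕ} (g : SPDMetric p) (P : StructureSpace n p) :
    Function.Surjective (psdDiff g P) := by
  rintro ⟨V, S⟩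
  obtain ⟨V', hV'⟩ := onbAdd_surjective (psdNeg g P).1 V
  obtain ⟨S', hS'⟩ := spdAdd_surjective g (psdNeg g P).2 S
  exact ⟨(V', S'), Prod.ext hV' hS'⟩

/-- The SPD logarithm is onto and left translations are onto; only the injectivity radius of the
Grassmannian forces t to be small. -/
theorem exists_structLog_psdDiff_eq_smul {n p : ℕ} (hp : p ≤ n) (g : SPDMetric p)
    (P : StructureSpace n p) (u : structTangent n p) :
    ∃ ε : ℝ, 0 < ε ∧ ∀ t : ℝ, 0 < t → t ≤ ε → ∃ (Q : StructureSpace n p)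
      (hQ : OffCut (baseProj n p) (tau (psdDiff g P Q).1)),
      structLog g (psdDiff g P Q) hQ = t • u := by
  obtain ⟨ε, hε, h⟩ := exists_grLog_eq_smul hp u.1.2
  refine ⟨ε, hε, fun t ht hte => ?_⟩
  obtain ⟨V, hV, hVu⟩ := h t ht hte
  obtain ⟨S, hS⟩ := exists_spdLog_eq g (t • u.2).2
  obtain ⟨Q, hQ⟩ := psdDiff_surjective g P (V, S)
  have hoff : OffCut (baseProj n p) (tau (psdDiff g P Q).1) := by rw [hQ]; exact hV
  refine ⟨Q, hoff, Prod.ext (Subtype.ext ?_) (Subtype.ext ?_)⟩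
  · change grLog (baseProj n p) (tau (psdDiff g P Q).1) = t • u.1.1
    rw [hQ, hVu]
  · change spdLog g (psdDiff g P Q).2 = t • u.2.1
    rw [hQ, hS]
    rfl

/-- If `p ≥ 1` and `n ≥ 2`, then the structure space has dimension at least two. -/
theorem exists_independent_structTangent {n p : ℕ} (hn : 2 ≤ n) (hp : 0 < p) :
    ∃ e f : structTangent n p, ∀ a b : ℝ, a • e + b • f = 0 → a = 0 ∧ b = 0 := by
  let E : Fin p → structTangent n p := fun i =>
    (0, ⟨Matrix.diagonal (Pi.single i 1), Matrix.diagonal_transpose _⟩)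
  -- For p = 1 the SPD factor is a line and the second direction is Grassmannian, available since n
  -- ≥ 2. For p ≥ 2 two diagonal directions suffice, which covers p = n, where the Grassmann tangent
  -- space is zero.
  rcases (Nat.succ_le_of_lt hp).eq_or_lt with h1 | h2
  · let i : Fin n := ⟨0, by omega⟩
    let j : Fin n := ⟨1, by omega⟩
    have hij : i ≠ j := by simp [i, j]
    let D : Matrix (Fin n) (Fin n) ℝ := Matrix.single i j 1 + Matrix.single j i 1
    have hD : D ∈ grTangent n p := by
      refine ⟨by simp [D, add_comm], ?_⟩
      subst h1
      ext k l
      simp only [D, baseProj, Matrix.add_apply, Matrix.mul_diagonal, Matrix.diagonal_mul,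
        Matrix.single_apply]
      by_cases hk : i = k
      · subst hk
        by_cases hl : j = l
        · subst hl
          simp [i, j]
        · simp [hij.symm, hl]
      · by_cases hk2 : j = k
        · subst hk2
          by_cases hl : i = l
          · subst hl
            simp [i, j]
          · simp [hij, hl]
        · simp [hk, hk2]
    refine ⟨E ⟨0, hp⟩, (⟨D, hD⟩, 0), fun a b h => ?_⟩
    have e1 := congrFun (congrFun (congrArg (fun v : structTangent n p => v.2.1) h) ⟨0, hp⟩)
      ⟨0, hp⟩
    have e2 := congrFun (congrFun (congrArg (fun v : structTangent n p => v.1.1) h) i) j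
    simp [E] at e1
    simp [E, D, hij, hij.symm] at e2
    exact ⟨e1, e2⟩
  · have hne : (⟨0, hp⟩ : Fin p) ≠ ⟨1, h2⟩ := by simp
    refine ⟨E ⟨0, hp⟩, E ⟨1, h2⟩, fun a b h => ?_⟩
    have h' := congrArg (fun v : structTangent n p => v.2.1) h
    have e1 := congrFun (congrFun h' ⟨0, hp⟩) ⟨0, hp⟩
    have e2 := congrFun (congrFun h' ⟨1, h2⟩) ⟨1, h2⟩
    simp [E] at e1 e2
    exact ⟨e1, e2⟩

/-- Lets the assumption ‖W‖ ≠ 0 exclude p = 0, where the tangent space is trivial. -/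
theorem psdNorm_eq_zero_of_rank_zero {n : ℕ} (lam : ℝ) (g : SPDMetric 0)
    (Q : StructureSpace n 0) : psdNorm lam g Q = 0 := by
  have hB : baseProj n 0 = 0 := by
    ext i j
    simp [baseProj, Matrix.diagonal_apply]
  have h1 : grInner n 0 (tau Q.1) (tau Q.1) = 0 := by
    simp [grInner, grLog, hB, matComm]
  have h2 : spdInner g Q.2 Q.2 = 0 := by
    cases g <;> simp [spdInner, spdMetricAtOne, Matrix.trace]
  rw [psdNorm, psdInner, h1, h2]
  simp

theorem gyroangle_eq_arccos_formCos {n p : ℕ} (lam : ℝ) (g : SPDMetric p)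
    {P Q R : StructureSpace n p} (hQ : OffCut (baseProj n p) (tau (psdDiff g P Q).1))
    (hR : OffCut (baseProj n p) (tau (psdDiff g P R).1)) :
    gyroangle lam g Q P R
      = Real.arccos (formCos (structForm n lam g) (structLog g (psdDiff g P Q) hQ)
        (structLog g (psdDiff g P R) hR)) := rfl

theorem gyrodist_comm {n p : ℕ} (lam : ℝ) (g : SPDMetric p) {P X : StructureSpace n p}
    (hP : OffCut (baseProj n p) (tau P.1)) (hX : OffCut (baseProj n p) (tau X.1))
    (hPX : OffCut (tau P.1) (tau X.1)) : gyrodist lam g P X = gyrodist lam g X P := by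
  change Real.sqrt (lam * grInner n p (tau (onbAdd (onbNeg P.1) X.1))
      (tau (onbAdd (onbNeg P.1) X.1)) + spdInner g (spdAdd g (spdNeg g P.2) X.2)
      (spdAdd g (spdNeg g P.2) X.2)) = _
  rw [grInner_diff_comm hP hX hPX, spdInner_diff_comm]
  rfl

/-- The distance is written here as d(P, X), the norm of the same vector ⊖P ⊕ X that enters the
angle; the symmetry of the distance is applied only in the final theorem. -/
theorem exists_isGyroMaximizer {n p : ℕ} (hn : 2 ≤ n) {g : SPDMetric p} {lam : ℝ}
    (hlam : 0 < lam) {W P X : StructureSpace n p} (hW : OffCut (baseProj n p) (tau W.1))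
    (hX : OffCut (baseProj n p) (tau (psdDiff g P X).1)) (hWn : psdNorm lam g W ≠ 0)
    (hXH : X ∉ hypergyroplane lam g W P) :
    (∃ R, IsGyroMaximizer lam g X W P R) ∧ ∀ R, IsGyroMaximizer lam g X W P R →
      Real.sin (gyroangle lam g X P R) * gyrodist lam g P X
        = |psdInner lam g (psdDiff g P X) W| / psdNorm lam g W := by
  have hp0 : 0 < p := by
    rcases Nat.eq_zero_or_pos p with rfl | h
    · exact absurd (psdNorm_eq_zero_of_rank_zero lam g W) hWn
    · exact h
  have hs := structForm_comm (n := n) lam g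
  have hp := structForm_self_nonneg (n := n) hlam g
  set B := structForm n lam g
  set w := structLog g W hW with hw
  set x := structLog g (psdDiff g P X) hX with hx
  have hww : 0 < B w w := by
    refine lt_of_le_of_ne (hp w) fun h => hWn ?_
    change Real.sqrt (B w w) = 0
    rw [← h, Real.sqrt_zero]
  -- The inner product with W is defined at X, so X can miss the hypergyroplane only through its
  -- value.
  have hxw : B x w ≠ 0 := fun h => hXH ⟨hX, h⟩
  obtain ⟨e, f, hef⟩ := exists_independent_structTangent hn hp0
  obtain ⟨u₀, hu₀, hu₀w⟩ := exists_ne_zero_form_eq_zero B w hef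
  obtain ⟨m, hm, ⟨u, hu, huw, hum⟩, hsin⟩ := exists_formCos_max hs hp hww hxw hu₀ hu₀w
  have hcos : ∀ Q (hQ : OffCut (baseProj n p) (tau (psdDiff g P Q).1)),
      Real.cos (gyroangle lam g Q P X) = formCos B (structLog g (psdDiff g P Q) hQ) x :=
    fun Q hQ => by
      rw [gyroangle_eq_arccos_formCos lam g hQ hX]
      exact cos_arccos_formCos hs hp _ _
  have hle : ∀ Q ∈ hypergyroplane lam g W P, Real.cos (gyroangle lam g Q P X) ≤ m := by
    rintro Q ⟨hQ, hQw⟩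
    rw [hcos Q hQ]
    exact hm _ hQw
  obtain ⟨R₀, hR₀, hR₀m⟩ : ∃ R ∈ hypergyroplane lam g W P \ {P},
      Real.cos (gyroangle lam g R P X) = m := by
    have hpn : p ≤ n := le_of_grONB P.1
    obtain ⟨ε, hε, h⟩ := exists_structLog_psdDiff_eq_smul hpn g P u
    have hmem : ∀ t : ℝ, 0 < t → ∀ (Q : StructureSpace n p)
        (hQ : OffCut (baseProj n p) (tau (psdDiff g P Q).1)),
        structLog g (psdDiff g P Q) hQ = t • u →
        Q ∈ hypergyroplane lam g W P ∧ Real.cos (gyroangle lam g Q P X) = m := by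
      intro t ht Q hQ hQt
      refine ⟨⟨hQ, ?_⟩, ?_⟩
      · change B (structLog g (psdDiff g P Q) hQ) w = 0
        rw [hQt, map_smul, LinearMap.smul_apply, huw, smul_zero]
      · rw [hcos Q hQ, hQt, hum t ht]
    -- Two points on the same optimal ray: their logarithms differ, so at most one of them is P, the
    -- point that must be avoided.
    obtain ⟨Q₁, h1, hQ₁⟩ := h ε hε le_rfl
    obtain ⟨Q₂, h2, hQ₂⟩ := h (ε / 2) (half_pos hε) (half_le_self hε.le)
    have m1 := hmem _ hε Q₁ h1 hQ₁
    have m2 := hmem _ (half_pos hε) Q₂ h2 hQ₂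
    by_cases hQP : Q₁ = P
    · refine ⟨Q₂, ⟨m2.1, fun h3 => ?_⟩, m2.2⟩
      have h4 : Q₁ = Q₂ := hQP.trans (Set.mem_singleton_iff.mp h3).symm
      subst h4
      have h5 := hQ₁.symm.trans hQ₂
      have h6 : ε = ε / 2 := smul_left_injective ℝ hu h5
      linarith
    · exact ⟨Q₁, ⟨m1.1, hQP⟩, m1.2⟩
  refine ⟨⟨R₀, hR₀, fun Q hQ => (hle Q hQ.1).trans hR₀m.ge⟩, ?_⟩
  rintro R ⟨hR, hRmax⟩
  -- All maximizers share the cosine m, hence the angle; this gives independence of the choice.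
  have hRm : Real.cos (gyroangle lam g R P X) = m :=
    le_antisymm (hle R hR.1) (hR₀m.ge.trans (hRmax R₀ hR₀))
  have hRx : formCos B x (structLog g (psdDiff g P R) hR.1.1) = m := by
    rw [formCos_comm hs, ← hcos R hR.1.1, hRm]
  rw [gyroangle_eq_arccos_formCos lam g hX hR.1.1, Real.sin_arccos]
  change Real.sqrt (1 - formCos B x _ ^ 2) * Real.sqrt (B x x) = |B x w| / Real.sqrt (B w w)
  rw [hRx, hsin]

theorem psdNorm_eq_sqrt {n p : ℕ} {lam : ℝ} (g : SPDMetric p) (W : StructureSpace n p) :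
    psdNorm lam g W = Real.sqrt (lam * grNorm n p (tau W.1) ^ 2 + spdNorm g W.2 ^ 2) := by
  have h1 : 0 ≤ grInner n p (tau W.1) (tau W.1) := by
    have := trace_transpose_mul_self_nonneg (grLog (baseProj n p) (tau W.1))
    rw [grInner]
    positivity
  have h2 : 0 ≤ spdInner g W.2 W.2 := spdMetricAtOne_self_nonneg g (spdLog_transpose g W.2)
  rw [grNorm, spdNorm, Real.sq_sqrt h1, Real.sq_sqrt h2]
  rfl

end StructureSpace

theorem theorem3p11 {n p : ℕ} (hn : 2 ≤ n) (g : SPDMetric p) (lam : ℝ) (hlam : 0 < lam)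
    (U_W U_P U_X : GrONB n p) (S_W S_P S_X : SPD p)
    (hUW : OffCut (baseProj n p) (tau U_W))
    (hUP : OffCut (baseProj n p) (tau U_P))
    (hUX : OffCut (baseProj n p) (tau U_X))
    (hPX : OffCut (tau U_P) (tau U_X))
    (hW : psdNorm lam g (U_W, S_W) ≠ 0) :
    pseudoGyrodist lam g (U_X, S_X) (U_W, S_W) (U_P, S_P)
        = |lam * grInner n p (tau (onbAdd (onbNeg U_P) U_X)) (tau U_W)
            + spdInner g (spdAdd g (spdNeg g S_P) S_X) S_W|
          / Real.sqrt (lam * grNorm n p (tau U_W) ^ 2 + spdNorm g S_W ^ 2) ∧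
      ((U_X, S_X) ∉ hypergyroplane lam g (U_W, S_W) (U_P, S_P) →
        (∃ R, IsGyroMaximizer lam g (U_X, S_X) (U_W, S_W) (U_P, S_P) R) ∧
        ∀ R, IsGyroMaximizer lam g (U_X, S_X) (U_W, S_W) (U_P, S_P) R →
          pseudoGyrodist lam g (U_X, S_X) (U_W, S_W) (U_P, S_P)
            = Real.sin (gyroangle lam g (U_X, S_X) (U_P, S_P) R)
              * gyrodist lam g (U_X, S_X) (U_P, S_P)) := by
  have hX : OffCut (baseProj n p) (tau (psdDiff g (U_P, S_P) (U_X, S_X)).1) :=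
    offCut_onbNeg_onbAdd hUP hPX
  have hnorm := psdNorm_eq_sqrt (lam := lam) g (U_W, S_W)
  change _ = |psdInner lam g (psdDiff g (U_P, S_P) (U_X, S_X)) (U_W, S_W)| / _ ∧ _
  rw [← hnorm]
  by_cases hXH : (U_X, S_X) ∈ hypergyroplane lam g (U_W, S_W) (U_P, S_P)
  · refine ⟨?_, fun h => absurd hXH h⟩
    rw [pseudoGyrodist, if_pos hXH, hXH.2, abs_zero, zero_div]
  · obtain ⟨hex, hval⟩ := exists_isGyroMaximizer (W := (U_W, S_W)) (P := (U_P, S_P))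
      (X := (U_X, S_X)) hn hlam hUW hX hW hXH
    rw [gyrodist_comm lam g (P := (U_P, S_P)) (X := (U_X, S_X)) hUP hUX hPX] at hval
    have hd : pseudoGyrodist lam g (U_X, S_X) (U_W, S_W) (U_P, S_P)
        = |psdInner lam g (psdDiff g (U_P, S_P) (U_X, S_X)) (U_W, S_W)|
          / psdNorm lam g (U_W, S_W) := by
      rw [pseudoGyrodist, if_neg hXH, dif_pos hex]
      exact hval _ hex.choose_spec
    exact ⟨hd, fun _ => ⟨hex, fun R hR => by rw [hd, hval R hR]⟩⟩
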